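/- **Theorem (error bound for balanced truncation of linear switched systems).** *Systems.* Fix integers $D\ge 1$ and $n,m,p\ge 0$, and put $\mathcal M=\{1,\dots,D\}$. A linear switched system of dimension $n$ with set of modes $\mathcal M$ is a family $\Sigma=(A_i,B_i,C_i)_{i\in \mathcal M}$ of real matrices, $A_i\in\mathbb R^{n\times n}$, $B_i\in\mathbb R^{n\times m}$, $C_i\in\mathbb R^{p\times n}$. Its input-output map $Y^\Sigma$ sends an input $u$ and a switching signal $q$ to the output $y(t)=C_{q(t)}x(t)$, where * in continuous time, $u\in L_2([0,\infty),\mathbb R^m)$, $q:[0,\infty)\to \mathcal M$ is piecewise continuous (finitely many discontinuities on every compact interval, with one-sided limits at each of them), and $x$ is the locally absolutely continuous function with $x(0)=0$ and $\dot x(t)=A_{q(t)}x(t)+B_{q(t)}u(t)$ for almost every $t\ge0$; * in discrete time, $u\in \ell_2(\mathbb N,\mathbb R^m)$, $q:\mathbb N\to \mathcal M$ is arbitrary, $x(0)=0$ and $x(t+1)=A_{q(t)}x(t)+B_{q(t)}u(t)$ for all $t\in\mathbb N$. *Norm.* Write $\|\cdot\|_2$ for the $L_2$ norm (continuous time) or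 the $\ell_2$ norm (discrete time), with respect to Euclidean norms of the values. For a map $F$ sending pairs $(u,q)$ as above to functions of time with values in $\mathbb R^p$, $\|F\|_{\mathcal L_2}$ is the infimum of all $\gamma>0$ such that $F(u,q)$ is square-integrable (square-summable) for all $(u,q)$ and $\sup_q\|F(u,q)\|_2\le\gamma\|u\|_2$ for all $u$; it is $+\infty$ if there is no such $\gamma$. *Grammians.* Let $P,Q\in\mathbb R^{n\times n}$ be symmetric positive definite matrices such that for every $i\in \mathcal M$, in continuous time $$A_iP+PA_i^T+B_iB_i^T\le 0,\qquad A_i^TQ+QA_i+C_i^TC_i\le 0,$$ and in discrete time $$A_iPA_i^T+B_iB_i^T-P\le 0,\qquad A_i^TQA_i+C_i^TC_i-Q\le 0 .$$ *Balanced truncation.* Let $U,K,\Lambda\in\mathbb R^{n\times n}$ be such that $P=UU^T$, $K$ is orthogonal, $\Lambda=\mathrm{diag}(\sigma_1,\dots,\sigma_n)$ with $\sigma_1\ge\dots\ge\sigma_n>0$, and $U^TQU=K\Lambda^2K^T$. Put $S=\Lambda^{1/2}K^TU^{-1}$. For $0\le r<n$ let $\hat\Sigma=(\hat A_i,\hat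 B_i,\hat C_i)_{i\in \mathcal M}$ be the system of dimension $r$ in which $\hat A_i$ is the upper left $r\times r$ block of $SA_iS^{-1}$, $\hat B_i$ consists of the first $r$ rows of $SB_i$, and $\hat C_i$ consists of the first $r$ columns of $C_iS^{-1}$. *Conclusion.* Both in continuous time and in discrete time, $$\|Y^{\Sigma}-Y^{\hat\Sigma}\|_{\mathcal L_2}\le 2\sum_{k=r+1}^{n}\sigma_k .$$ -/

import Mathlib

namespace SwitchedSystem

open MeasureTheory Set Filter
open scoped Topology NNReal ENNReal BoundedContinuousFunction

/-- Carathéodory solutions of the linear integral equation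
`x t = x₀ + ∫ s in 0..t, (F s (x s) + g s)`, by a contraction in an exponentially weighted norm. -/
theorem exists_continuous_integral_solution {X : Type*} [NormedAddCommGroup X] [NormedSpace ℝ X]
    [CompleteSpace X] (F : ℝ → X →L[ℝ] X) (hF : AEStronglyMeasurable F volume) (M : ℝ)
    (hM : ∀ t, ‖F t‖ ≤ M) (g : ℝ → X) (hg : ∀ a b, IntervalIntegrable g volume a b)
    (c : ℝ) (hc : ∀ t, 0 ≤ t → ‖∫ s in (0 : ℝ)..t, g s‖ ≤ c + c * t) (x₀ : X) :
    ∃ x : ℝ → X, (∀ a b, IntervalIntegrable (fun s => F s (x s) + g s) volume a b) ∧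
      x = fun t => x₀ + ∫ s in (0 : ℝ)..(max t 0), (F s (x s) + g s) := by
  have hM0 : 0 ≤ M := (norm_nonneg _).trans (hM 0)
  have hc0 : 0 ≤ c := by simpa using (norm_nonneg _).trans (hc 0 le_rfl)
  set L : ℝ := 2 * M + 1 with hL
  have hL0 : 0 < L := by positivity
  -- integrability of the linear term
  have hint : ∀ z : ℝ → X, Continuous z → ∀ a b,
      IntervalIntegrable (fun s => F s (z s)) volume a b := by
    intro z hz a b
    have h1 : IntervalIntegrable (fun s => M * ‖z s‖) volume a b :=
      (continuous_const.mul hz.norm).intervalIntegrable a b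
    refine h1.mono_fun ?_ ?_
    · exact ((ContinuousLinearMap.id ℝ _).aestronglyMeasurable_comp₂ (hF.restrict)
        hz.aestronglyMeasurable)
    · refine ae_of_all _ fun s => ?_
      change ‖F s (z s)‖ ≤ ‖M * ‖z s‖‖
      rw [Real.norm_of_nonneg (by positivity)]
      exact ((F s).le_opNorm _).trans (by gcongr; exact hM s)
  have hEc : Continuous fun s : ℝ => Real.exp (L * s) := by fun_prop
  have hexp : ∀ τ : ℝ, ∫ s in (0 : ℝ)..τ, Real.exp (L * s) = (Real.exp (L * τ) - 1) / L := by
    intro τ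
    rw [intervalIntegral.integral_comp_mul_left _ hL0.ne', integral_exp]
    simp [div_eq_inv_mul]
  -- weighted linear term
  let lin : (ℝ → X) → ℝ → X := fun z t =>
    Real.exp (-(L * max t 0)) • ∫ s in (0 : ℝ)..(max t 0), F s (Real.exp (L * s) • z s)
  have hlin_cont : ∀ z : ℝ → X, Continuous z → Continuous (lin z) := by
    intro z hz
    have h1 := intervalIntegral.continuous_primitive
      (hint (fun s => Real.exp (L * s) • z s) (hEc.smul hz)) 0
    exact (Real.continuous_exp.comp (by fun_prop)).smul
      (h1.comp (continuous_id.max continuous_const))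
  have hlin_bd : ∀ (z : ℝ → X) (K : ℝ), 0 ≤ K → (∀ s, ‖z s‖ ≤ K) →
      ∀ t, ‖lin z t‖ ≤ (1 / 2) * K := by
    intro z K hK hz t
    set τ := max t 0 with hτ
    have hτ0 : 0 ≤ τ := le_max_right _ _
    have h1 : ‖∫ s in (0 : ℝ)..τ, F s (Real.exp (L * s) • z s)‖ ≤
        ∫ s in (0 : ℝ)..τ, (M * K) * Real.exp (L * s) := by
      refine intervalIntegral.norm_integral_le_of_norm_le hτ0 (ae_of_all _ fun s _ => ?_)
        ((continuous_const.mul hEc).intervalIntegrable _ _)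
      calc ‖F s (Real.exp (L * s) • z s)‖ ≤ ‖F s‖ * ‖Real.exp (L * s) • z s‖ := (F s).le_opNorm _
        _ = ‖F s‖ * (Real.exp (L * s) * ‖z s‖) := by
          rw [norm_smul, Real.norm_of_nonneg (Real.exp_pos _).le]
        _ ≤ M * (Real.exp (L * s) * K) := by gcongr; exacts [hM s, hz s]
        _ = _ := by ring
    rw [intervalIntegral.integral_const_mul, hexp] at h1
    change ‖Real.exp (-(L * τ)) • _‖ ≤ _
    rw [norm_smul, Real.norm_of_nonneg (Real.exp_pos _).le]
    calc Real.exp (-(L * τ)) * ‖∫ s in (0 : ℝ)..τ, F s (Real.exp (L * s) • z s)‖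
        ≤ Real.exp (-(L * τ)) * (M * K * ((Real.exp (L * τ) - 1) / L)) := by gcongr
      _ = (M / L) * K * (1 - Real.exp (-(L * τ))) := by
        have : Real.exp (-(L * τ)) * Real.exp (L * τ) = 1 := by rw [← Real.exp_add]; simp
        field_simp
        linear_combination (M * K) * this
      _ ≤ (M / L) * K * 1 := by
        gcongr
        linarith [Real.exp_pos (-(L * τ))]
      _ ≤ (1 / 2) * K := by
        rw [mul_one]
        refine mul_le_mul_of_nonneg_right ?_ hK
        rw [div_le_div_iff₀ hL0 two_pos]
        linarith
  -- forcing term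
  let h : ℝ → X := fun t =>
    Real.exp (-(L * max t 0)) • (x₀ + ∫ s in (0 : ℝ)..(max t 0), g s)
  have hh_cont : Continuous h := by
    have h1 := intervalIntegral.continuous_primitive hg 0
    exact (Real.continuous_exp.comp (by fun_prop)).smul
      (continuous_const.add (h1.comp (continuous_id.max continuous_const)))
  have hh_bd : ∀ t, ‖h t‖ ≤ ‖x₀‖ + c + c := by
    intro t
    set τ := max t 0 with hτ
    have hτ0 : 0 ≤ τ := le_max_right _ _
    change ‖Real.exp (-(L * τ)) • _‖ ≤ _
    rw [norm_smul, Real.norm_of_nonneg (Real.exp_pos _).le]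
    have e1 : Real.exp (-(L * τ)) ≤ 1 := Real.exp_le_one_iff.2 (by nlinarith)
    have e2 : Real.exp (-(L * τ)) * τ ≤ 1 := by
      have h2 : τ ≤ Real.exp (L * τ) := by
        have := Real.add_one_le_exp (L * τ)
        nlinarith
      calc Real.exp (-(L * τ)) * τ ≤ Real.exp (-(L * τ)) * Real.exp (L * τ) := by gcongr
        _ = 1 := by rw [← Real.exp_add]; simp
    calc _ ≤ Real.exp (-(L * τ)) * (‖x₀‖ + (c + c * τ)) := by
          gcongr
          exact (norm_add_le _ _).trans (by gcongr; exact hc τ hτ0)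
      _ = Real.exp (-(L * τ)) * (‖x₀‖ + c) + c * (Real.exp (-(L * τ)) * τ) := by ring
      _ ≤ 1 * (‖x₀‖ + c) + c * 1 := by gcongr
      _ = _ := by ring
  let Ψ : (ℝ →ᵇ X) → (ℝ →ᵇ X) := fun z =>
    BoundedContinuousFunction.ofNormedAddCommGroup (fun t => h t + lin z t)
      (hh_cont.add (hlin_cont z z.continuous)) (‖x₀‖ + c + c + (1 / 2) * ‖z‖)
      (fun t => (norm_add_le _ _).trans
        (add_le_add (hh_bd t) (hlin_bd z _ (norm_nonneg _) z.norm_coe_le_norm t)))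
  have hcontr : ContractingWith (1 / 2 : ℝ≥0) Ψ := by
    refine ⟨by rw [← NNReal.coe_lt_coe]; norm_num, LipschitzWith.of_dist_le_mul fun z w => ?_⟩
    rw [BoundedContinuousFunction.dist_le (by positivity)]
    intro t
    have e : Ψ z t - Ψ w t = lin (fun s => z s - w s) t := by
      change (h t + lin z t) - (h t + lin w t) = _
      rw [add_sub_add_left_eq_sub]
      simp only [lin]
      rw [← smul_sub, ← intervalIntegral.integral_sub
        (hint (fun s => Real.exp (L * s) • z s) (hEc.smul z.continuous) _ _)
        (hint (fun s => Real.exp (L * s) • w s) (hEc.smul w.continuous) _ _)]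
      simp only [smul_sub, map_sub]
    rw [dist_eq_norm, e]
    have := hlin_bd (fun s => z s - w s) (dist z w) dist_nonneg
      (fun s => by rw [← dist_eq_norm]; exact BoundedContinuousFunction.dist_coe_le_dist s) t
    simpa using this
  obtain ⟨z, hz⟩ : ∃ z, Ψ z = z := ⟨_, hcontr.fixedPoint_isFixedPt⟩
  have hzt : ∀ t, h t + lin z t = z t := fun t => DFunLike.congr_fun hz t
  let x : ℝ → X := fun t => Real.exp (L * max t 0) • z t
  have hxc : Continuous x := (Real.continuous_exp.comp (by fun_prop)).smul z.continuous
  refine ⟨x, fun a b => (hint x hxc a b).add (hg a b), ?_⟩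
  funext t
  have hτ0 : 0 ≤ max t 0 := le_max_right _ _
  have e1 : ∫ s in (0 : ℝ)..(max t 0), F s (Real.exp (L * s) • z s) =
      ∫ s in (0 : ℝ)..(max t 0), F s (x s) := by
    refine intervalIntegral.integral_congr fun s hs => ?_
    rw [uIcc_of_le hτ0] at hs
    simp only [x, max_eq_left hs.1]
  rw [intervalIntegral.integral_add (hint x hxc _ _) (hg _ _), ← e1]
  change Real.exp (L * max t 0) • z t = _
  rw [← hzt t]
  simp only [h, lin]
  rw [smul_add, smul_smul, smul_smul, ← Real.exp_add]
  simp only [add_neg_cancel, Real.exp_zero, one_smul]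
  abel

/-- Primitives of interval integrable vector-valued functions are absolutely continuous. -/
theorem absolutelyContinuousOnInterval_primitive {X : Type*} [NormedAddCommGroup X]
    [NormedSpace ℝ X] (f : ℝ → X) (T : ℝ)
    (hf : IntervalIntegrable f volume 0 T) :
    AbsolutelyContinuousOnInterval (fun t => ∫ s in (0 : ℝ)..t, f s) 0 T := by
  have hG := hf.norm.absolutelyContinuousOnInterval_intervalIntegral (left_mem_uIcc)
  rw [absolutelyContinuousOnInterval_iff] at hG ⊢
  intro ε hε
  obtain ⟨δ, hδ, H⟩ := hG ε hε
  refine ⟨δ, hδ, fun E hE hlt => lt_of_le_of_lt (Finset.sum_le_sum fun i hi => ?_) (H E hE hlt)⟩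
  obtain ⟨ha, hb⟩ := hE.1 i hi
  have ia : IntervalIntegrable f volume 0 (E.2 i).1 :=
    hf.mono_set (uIcc_subset_uIcc left_mem_uIcc ha)
  have ib : IntervalIntegrable f volume 0 (E.2 i).2 :=
    hf.mono_set (uIcc_subset_uIcc left_mem_uIcc hb)
  rw [dist_comm, dist_comm (∫ s in (0 : ℝ)..(E.2 i).1, ‖f s‖), dist_eq_norm, Real.dist_eq,
    intervalIntegral.integral_interval_sub_left ib ia,
    intervalIntegral.integral_interval_sub_left ib.norm ia.norm]
  exact intervalIntegral.norm_integral_le_abs_integral_norm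

/-! ### Signals -/

/-- The continuous time axis `[0, ∞)`, as Lebesgue measure on the non-negative reals.
Continuous-time signals are functions on `ℝ` whose values at negative times are irrelevant. -/
noncomputable abbrev contTime : Measure ℝ := volume.restrict (Ici 0)

/-- The discrete time axis `ℕ`, as counting measure. -/
noncomputable abbrev discTime : Measure ℕ := Measure.count

/-- The space of inputs with values in `ℝ^m`: `L₂([0, ∞), ℝ^m)` for `μ = contTime` and
`ℓ₂(ℕ, ℝ^m)` for `μ = discTime`. -/
abbrev L2Signal {T : Type} [MeasurableSpace T] (μ : Measure T) (m : ℕ) : Type :=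
  {u : T → EuclideanSpace ℝ (Fin m) // MemLp u 2 μ}

/-- Piecewise continuity of `f` on `[0, ∞)`: finitely many points of discontinuity on every compact
subinterval, and one-sided limits at each of them. -/
structure IsPiecewiseContinuous {E : Type} [TopologicalSpace E] (f : ℝ → E) : Prop where
  finite_discontinuities : ∀ a b : ℝ, 0 ≤ a →
    {t ∈ Icc a b | ¬ ContinuousWithinAt f (Ici 0) t}.Finite
  right_limit : ∀ t : ℝ, 0 ≤ t → ¬ ContinuousWithinAt f (Ici 0) t →
    ∃ l, Tendsto f (𝓝[>] t) (𝓝 l)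
  left_limit : ∀ t : ℝ, 0 < t → ¬ ContinuousWithinAt f (Ici 0) t →
    ∃ l, Tendsto f (𝓝[<] t) (𝓝 l)

/-- Continuous-time switching signals: piecewise continuous maps into the finite discrete
set of modes. -/
abbrev ContSwitching (D : ℕ) : Type := {q : ℝ → Fin D // IsPiecewiseContinuous q}

/-- Discrete-time switching signals: infinite words over the set of modes. -/
abbrev DiscSwitching (D : ℕ) : Type := ℕ → Fin D

/-! ### The induced norm of an input-output map -/

/-- `γ` is an `L₂` (`ℓ₂`) gain of the map `F`, which sends an input `u` and a switching signal `q`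
to an output. -/
def HasL2Gain {T W : Type} [MeasurableSpace T] {μ : Measure T} {m p : ℕ}
    (F : L2Signal μ m → W → T → EuclideanSpace ℝ (Fin p)) (γ : ℝ≥0) : Prop :=
  (∀ u q, MemLp (F u q) 2 μ) ∧ ∀ u, ⨆ q, eLpNorm (F u q) 2 μ ≤ γ * eLpNorm u.1 2 μ

/-- The `L₂` (`ℓ₂`) norm of an input-output map: the infimum of its positive gains, and `∞` if
there is none. -/
noncomputable def l2Norm {T W : Type} [MeasurableSpace T] {μ : Measure T} {m p : ℕ}
    (F : L2Signal μ m → W → T → EuclideanSpace ℝ (Fin p)) : ℝ≥0∞ :=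
  ⨅ (γ : ℝ≥0) (_ : 0 < γ ∧ HasL2Gain F γ), (γ : ℝ≥0∞)

/-! ### Linear switched systems -/

/-- Linear switched systems with `D` modes, state space `ℝ^n`, input space `ℝ^m` and output
space `ℝ^p`. -/
structure LSS (D n m p : ℕ) where
  A : Fin D → Matrix (Fin n) (Fin n) ℝ
  B : Fin D → Matrix (Fin n) (Fin m) ℝ
  C : Fin D → Matrix (Fin p) (Fin n) ℝ

namespace LSS

variable {D n m p : ℕ}

/-- `x` is the continuous-time state trajectory of `S` from `x₀` for the input `u` and the switching
signal `q`: it is absolutely continuous (on bounded intervals), starts at `x₀` and satisfies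
`x' = A_q x + B_q u` almost everywhere on `[0, ∞)`. -/
structure IsContTrajectory (S : LSS D n m p) (x₀ : EuclideanSpace ℝ (Fin n))
    (u : L2Signal contTime m) (q : ContSwitching D) (x : ℝ → EuclideanSpace ℝ (Fin n)) : Prop where
  initial : x 0 = x₀
  absolutelyContinuous : ∀ T : ℝ, 0 ≤ T → AbsolutelyContinuousOnInterval x 0 T
  hasDerivAt : ∀ᵐ t ∂contTime, HasDerivAt x
    ((S.A (q.1 t)).toEuclideanLin (x t) + (S.B (q.1 t)).toEuclideanLin (u.1 t)) t

/-- Switching signals are measurable up to null sets on `[0, ∞)`. -/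
theorem aestronglyMeasurable_switching (q : ContSwitching D) :
    AEStronglyMeasurable q.1 contTime := by
  set N : Set ℝ := {t ∈ Ici (0 : ℝ) | ¬ ContinuousWithinAt q.1 (Ici 0) t} with hN
  have hNc : N.Countable := by
    have : N ⊆ ⋃ k : ℕ, {t ∈ Icc (0 : ℝ) k | ¬ ContinuousWithinAt q.1 (Ici 0) t} := by
      intro t ht
      obtain ⟨k, hk⟩ := exists_nat_ge t
      exact mem_iUnion.2 ⟨k, ⟨ht.1, hk⟩, ht.2⟩
    exact (countable_iUnion fun k : ℕ =>
      (q.2.finite_discontinuities 0 k le_rfl).countable).mono this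
  have hcont : ContinuousOn q.1 (Ici 0 \ N) := by
    intro t ht
    have : ContinuousWithinAt q.1 (Ici 0) t := by
      by_contra hcon
      exact ht.2 ⟨ht.1, hcon⟩
    exact this.mono sdiff_subset
  have h1 : AEStronglyMeasurable q.1 (volume.restrict (Ici 0 \ N)) :=
    hcont.aestronglyMeasurable (measurableSet_Ici.diff hNc.measurableSet)
  have h2 : (volume.restrict (Ici (0 : ℝ) \ N)) = volume.restrict (Ici 0) :=
    Measure.restrict_congr_set (sdiff_null_ae_eq_self (hNc.measure_zero _))
  rwa [h2] at h1

/-- Existence of trajectories, with the matrices as continuous linear maps. -/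
theorem exists_absolutelyContinuous_solution {X V : Type} [NormedAddCommGroup X]
    [NormedSpace ℝ X] [CompleteSpace X] [NormedAddCommGroup V] [NormedSpace ℝ V]
    (FA : Fin D → X →L[ℝ] X) (FB : Fin D → V →L[ℝ] X) (x₀ : X) (u : ℝ → V)
    (hu : MemLp u 2 contTime) (q : ContSwitching D) :
    ∃ x : ℝ → X, x 0 = x₀ ∧ (∀ T : ℝ, 0 ≤ T → AbsolutelyContinuousOnInterval x 0 T) ∧
      ∀ᵐ t ∂contTime, HasDerivAt x (FA (q.1 t) (x t) + FB (q.1 t) (u t)) t := by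
  let F : ℝ → X →L[ℝ] X := (Ici (0 : ℝ)).indicator fun t => FA (q.1 t)
  let g : ℝ → X := (Ici (0 : ℝ)).indicator fun t => FB (q.1 t) (u t)
  have hq := aestronglyMeasurable_switching q
  have hFA : AEStronglyMeasurable (fun t => FA (q.1 t)) contTime :=
    (continuous_of_discreteTopology (f := FA)).comp_aestronglyMeasurable hq
  have hFB : AEStronglyMeasurable (fun t => FB (q.1 t)) contTime :=
    (continuous_of_discreteTopology (f := FB)).comp_aestronglyMeasurable hq
  have hF : AEStronglyMeasurable F volume :=
    (aestronglyMeasurable_indicator_iff measurableSet_Ici).2 hFA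
  have hM : ∀ t, ‖F t‖ ≤ ∑ i, ‖FA i‖ := by
    intro t
    refine (norm_indicator_le_norm_self (fun t => FA (q.1 t)) t).trans ?_
    exact Finset.single_le_sum (f := fun i => ‖FA i‖) (fun _ _ => norm_nonneg _)
      (Finset.mem_univ (q.1 t))
  set b : ℝ := ∑ i, ‖FB i‖ with hb
  have hb0 : 0 ≤ b := Finset.sum_nonneg fun _ _ => norm_nonneg _
  have hbi : ∀ i, ‖FB i‖ ≤ b := fun i =>
    Finset.single_le_sum (f := fun i => ‖FB i‖) (fun _ _ => norm_nonneg _) (Finset.mem_univ i)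
  have hgm : AEStronglyMeasurable g volume :=
    (aestronglyMeasurable_indicator_iff measurableSet_Ici).2
      ((ContinuousLinearMap.id ℝ _).aestronglyMeasurable_comp₂ hFB hu.1)
  have hu2 : IntegrableOn (fun t => ‖u t‖ ^ 2) (Ici 0) volume :=
    (memLp_two_iff_integrable_sq_norm hu.1).1 hu
  let v : ℝ → ℝ := (Ici (0 : ℝ)).indicator fun t => ‖u t‖ ^ 2
  have hv : Integrable v volume := (integrable_indicator_iff measurableSet_Ici).2 hu2
  have hv0 : ∀ t, 0 ≤ v t := fun t => indicator_nonneg (fun _ _ => by positivity) t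
  have hgb : ∀ t, ‖g t‖ ≤ b * (1 + v t) := by
    intro t
    by_cases ht : t ∈ Ici (0 : ℝ)
    · simp only [g, v, indicator_of_mem ht]
      refine ((FB (q.1 t)).le_opNorm _).trans (mul_le_mul (hbi _) ?_ (norm_nonneg _) hb0)
      nlinarith [sq_nonneg (‖u t‖ - 1), norm_nonneg (u t)]
    · simp only [g, v, indicator_of_notMem ht]
      simpa using hb0
  have hbv : ∀ a c, IntervalIntegrable (fun t => b * (1 + v t)) volume a c := fun a c =>
    ((intervalIntegrable_const).add hv.intervalIntegrable).const_mul b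
  have hg : ∀ a c, IntervalIntegrable g volume a c := fun a c =>
    (hbv a c).mono_fun hgm.restrict
      (ae_of_all _ fun t => (hgb t).trans (le_abs_self _))
  have hc : ∀ t, 0 ≤ t → ‖∫ s in (0 : ℝ)..t, g s‖ ≤
      b * (1 + ∫ s, v s) + b * (1 + ∫ s, v s) * t := by
    intro t ht
    have hI0 : 0 ≤ ∫ s, v s := integral_nonneg hv0
    refine (intervalIntegral.norm_integral_le_of_norm_le ht (ae_of_all _ fun s _ => hgb s)
      (hbv 0 t)).trans ?_
    rw [intervalIntegral.integral_const_mul,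
      intervalIntegral.integral_add intervalIntegrable_const hv.intervalIntegrable]
    have h1 : ∫ s in (0 : ℝ)..t, v s ≤ ∫ s, v s := by
      rw [intervalIntegral.integral_of_le ht]
      exact setIntegral_le_integral hv (ae_of_all _ hv0)
    simp only [intervalIntegral.integral_const, sub_zero, smul_eq_mul, mul_one]
    have h2 : 0 ≤ b * ((∫ s, v s) * t) := by positivity
    have h3 : b * ∫ s in (0 : ℝ)..t, v s ≤ b * ∫ s, v s := by gcongr
    nlinarith
  obtain ⟨x, hint, hx⟩ :=
    exists_continuous_integral_solution F hF (∑ i, ‖FA i‖) hM g hg _ hc x₀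
  have hxt : ∀ t, 0 ≤ t → x t = x₀ + ∫ s in (0 : ℝ)..t, (F s (x s) + g s) := by
    intro t ht
    conv_lhs => rw [hx]
    simp only [max_eq_left ht]
  have hloc : LocallyIntegrable (fun s => F s (x s) + g s) volume := by
    intro t
    refine ⟨Ioc (t - 1) (t + 1), Ioc_mem_nhds (by linarith) (by linarith), ?_⟩
    exact (intervalIntegrable_iff_integrableOn_Ioc_of_le (by linarith)).1 (hint (t - 1) (t + 1))
  refine ⟨x, by simpa using hxt 0 le_rfl, fun T hT => ?_, ?_⟩
  · have h1 := absolutelyContinuousOnInterval_primitive _ T (hint 0 T)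
    rw [absolutelyContinuousOnInterval_iff] at h1 ⊢
    intro ε hε
    obtain ⟨δ, hδ, H⟩ := h1 ε hε
    refine ⟨δ, hδ, fun E hE hlt => lt_of_eq_of_lt (Finset.sum_congr rfl fun i hi => ?_)
      (H E hE hlt)⟩
    have h2 := hE.1 i hi
    rw [uIcc_of_le hT] at h2
    rw [hxt _ h2.1.1, hxt _ h2.2.1, dist_add_left]
  · have h1 : ∀ᵐ t ∂(volume.restrict (Ici (0 : ℝ))), 0 < t := by
      rw [← restrict_Ioi_eq_restrict_Ici]
      exact ae_restrict_mem measurableSet_Ioi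
    filter_upwards [h1, ae_restrict_of_ae (_root_.LocallyIntegrable.ae_hasDerivAt_integral hloc)] with t ht hd
    have h2 := (hd 0).const_add x₀
    have h3 : F t (x t) + g t = FA (q.1 t) (x t) + FB (q.1 t) (u t) := by
      simp only [F, g, indicator_of_mem (show t ∈ Ici (0 : ℝ) from ht.le)]
    rw [h3] at h2
    refine h2.congr_of_eventuallyEq ?_
    filter_upwards [Ioi_mem_nhds ht] with s hs
    exact hxt s (le_of_lt hs)

/-- For every initial state, input and switching signal a trajectory exists. -/
theorem exists_isContTrajectory (S : LSS D n m p) (x₀ : EuclideanSpace ℝ (Fin n))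
    (u : L2Signal contTime m) (q : ContSwitching D) : ∃ x, S.IsContTrajectory x₀ u q x := by
  obtain ⟨x, h0, h1, h2⟩ := exists_absolutelyContinuous_solution
    (fun i => (S.A i).toEuclideanLin.toContinuousLinearMap)
    (fun i => (S.B i).toEuclideanLin.toContinuousLinearMap) x₀ u.1 u.2 q
  exact ⟨x, h0, h1, h2⟩

/-- The continuous-time input-state map of `S` from the initial state `x₀`: the trajectory, which is
unique at non-negative times. -/
noncomputable def contState (S : LSS D n m p) (x₀ : EuclideanSpace ℝ (Fin n))
    (u : L2Signal contTime m) (q : ContSwitching D) : ℝ → EuclideanSpace ℝ (Fin n) :=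
  Classical.choose (S.exists_isContTrajectory x₀ u q)

/-- The continuous-time input-output map `Y^S` of `S`, with zero initial state:
`y t = C_{q t} x t`. -/
noncomputable def contOutput (S : LSS D n m p) (u : L2Signal contTime m) (q : ContSwitching D) :
    ℝ → EuclideanSpace ℝ (Fin p) :=
  fun t => (S.C (q.1 t)).toEuclideanLin (S.contState 0 u q t)

/-- The discrete-time input-state map of `S` from the initial state `x₀`:
`x (t + 1) = A_{q t} x t + B_{q t} u t`, `x 0 = x₀`. -/
noncomputable def discState (S : LSS D n m p) (x₀ : EuclideanSpace ℝ (Fin n))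
    (u : L2Signal discTime m) (q : DiscSwitching D) : ℕ → EuclideanSpace ℝ (Fin n)
  | 0 => x₀
  | t + 1 => (S.A (q t)).toEuclideanLin (S.discState x₀ u q t) + (S.B (q t)).toEuclideanLin (u.1 t)

/-- The discrete-time input-output map `Y^S` of `S`, with zero initial state:
`y t = C_{q t} x t`. -/
noncomputable def discOutput (S : LSS D n m p) (u : L2Signal discTime m) (q : DiscSwitching D) :
    ℕ → EuclideanSpace ℝ (Fin p) :=
  fun t => (S.C (q t)).toEuclideanLin (S.discState 0 u q t)

/-! ### Grammians -/

/-- `Q > 0` is a continuous-time observability grammian: `A_iᵀ Q + Q A_i + C_iᵀ C_i ≤ 0` for every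
mode `i`. Here and below `M ≤ 0` for a symmetric matrix `M` is expressed as `(-M).PosSemidef`. -/
def IsContObsGrammian (S : LSS D n m p) (Q : Matrix (Fin n) (Fin n) ℝ) : Prop :=
  Q.PosDef ∧ ∀ i, (-((S.A i).transpose * Q + Q * S.A i + (S.C i).transpose * S.C i)).PosSemidef

/-- `P > 0` is a continuous-time controllability grammian:
`A_i P + P A_iᵀ + B_i B_iᵀ ≤ 0` for every mode `i`. -/
def IsContCtrGrammian (S : LSS D n m p) (P : Matrix (Fin n) (Fin n) ℝ) : Prop :=
  P.PosDef ∧ ∀ i, (-(S.A i * P + P * (S.A i).transpose + S.B i * (S.B i).transpose)).PosSemidef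

/-- `Q > 0` is a discrete-time observability grammian:
`A_iᵀ Q A_i + C_iᵀ C_i - Q ≤ 0` for every mode `i`. -/
def IsDiscObsGrammian (S : LSS D n m p) (Q : Matrix (Fin n) (Fin n) ℝ) : Prop :=
  Q.PosDef ∧ ∀ i, (-((S.A i).transpose * Q * S.A i + (S.C i).transpose * S.C i - Q)).PosSemidef

/-- `P > 0` is a discrete-time controllability grammian:
`A_i P A_iᵀ + B_i B_iᵀ - P ≤ 0` for every mode `i`. -/
def IsDiscCtrGrammian (S : LSS D n m p) (P : Matrix (Fin n) (Fin n) ℝ) : Prop :=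
  P.PosDef ∧ ∀ i, (-(S.A i * P * (S.A i).transpose + S.B i * (S.B i).transpose - P)).PosSemidef

/-! ### Balanced truncation -/

/-- The system obtained from `S` by the change of state coordinates `x ↦ R x`. -/
noncomputable def changeBasis (S : LSS D n m p) (R : Matrix (Fin n) (Fin n) ℝ) : LSS D n m p where
  A i := R * S.A i * R⁻¹
  B i := R * S.B i
  C i := S.C i * R⁻¹

/-- The system obtained from `S` by keeping the first `r` state components. -/
def truncate (S : LSS D n m p) (r : ℕ) (hr : r ≤ n) : LSS D r m p where
  A i := (S.A i).submatrix (Fin.castLE hr) (Fin.castLE hr)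
  B i := (S.B i).submatrix (Fin.castLE hr) id
  C i := (S.C i).submatrix id (Fin.castLE hr)

/-- `Shat` is a system of dimension `r` returned by balanced truncation of `S` for the grammians
`P` and `Q`, and `σ` lists the diagonal of the balanced grammian `Λ`, in decreasing order:
`P = U Uᵀ` and `Uᵀ Q U = K Λ² Kᵀ` with `K` orthogonal and `Λ = diag(σ)`, and `Shat` consists of the
first `r` state components of `S` in the coordinates given by `Λ^(1/2) Kᵀ U⁻¹`. -/
def IsBalancedTruncation (S : LSS D n m p) (P Q : Matrix (Fin n) (Fin n) ℝ) (σ : Fin n → ℝ)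
    (r : ℕ) (Shat : LSS D r m p) : Prop :=
  ∃ (hr : r < n) (U K : Matrix (Fin n) (Fin n) ℝ),
    P = U * U.transpose ∧
    K ∈ Matrix.orthogonalGroup (Fin n) ℝ ∧
    (∀ k, 0 < σ k) ∧ Antitone σ ∧
    U.transpose * Q * U = K * Matrix.diagonal σ ^ 2 * K.transpose ∧
    Shat = (S.changeBasis
      (Matrix.diagonal (fun k => √(σ k)) * K.transpose * U⁻¹)).truncate r hr.le

end LSS

end SwitchedSystem

/-! In balanced coordinates both grammians equal Λ = diag(σ), and states can be removed one at a
time. Let `x` be a state of the balanced system and `X` the state of the system without its last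
component `l`, padded by a zero there. Then `X` obeys the full equation except that component `l` of
its vector field, call it `w`, is suppressed.

The observability inequality is applied to `x - X`, which sees no input, and the controllability
inequality to `x + X`, which is driven by `2u`. In continuous time the suppressed `w` adds `2 σ_l
x_l w` to the derivative of `(x - X)ᵀ Λ (x - X)` and `-2 σ_l⁻¹ x_l w` to that of `(x + X)ᵀ Λ⁻¹ (x +
X)`. In `storage` the second form has weight `σ_l²`, so these terms cancel; in discrete time they
leave `-2 σ_l w² ≤ 0`. Hence `storage` grows at rate at most `(2 σ_l)² |u|² - |y - y'|²`
(`IsContBalanced.storage_rate_le`, `IsDiscBalanced.storage_le`). It starts at zero and stays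
nonnegative, so integrating or summing gives `‖y - y'‖ ≤ 2 σ_l ‖u‖`. The mode enters only through
inequalities valid for every mode, so the switching signal is irrelevant.

The truncated system is again balanced, with the remaining σ's, so `output_sub_truncate_of_step`
iterates the bound and adds the errors by the triangle inequality. -/

namespace SwitchedSystem

open MeasureTheory Set Filter Matrix
open scoped Topology NNReal ENNReal

namespace LSS

variable {D n m p : ℕ}

/-! ### Balanced dissipation inequalities and the storage function -/

/-- The dissipation inequalities expressing that `diag(σ)` is both a controllability and an
observability grammian of `S`, in continuous time. -/
structure IsContBalanced (S : LSS D n m p) (σ : Fin n → ℝ) : Prop where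
  pos : ∀ k, 0 < σ k
  obs : ∀ i x, 2 * (∑ k, σ k * (x k * (S.A i *ᵥ x) k)) + S.C i *ᵥ x ⬝ᵥ S.C i *ᵥ x ≤ 0
  ctr : ∀ i x v, 2 * (∑ k, (σ k)⁻¹ * (x k * (S.A i *ᵥ x + S.B i *ᵥ v) k)) ≤ v ⬝ᵥ v

/-- The dissipation inequalities expressing that `diag(σ)` is both a controllability and an
observability grammian of `S`, in discrete time. -/
structure IsDiscBalanced (S : LSS D n m p) (σ : Fin n → ℝ) : Prop where
  pos : ∀ k, 0 < σ k
  obs : ∀ i x, ∑ k, σ k * (S.A i *ᵥ x) k ^ 2 + S.C i *ᵥ x ⬝ᵥ S.C i *ᵥ x ≤ ∑ k, σ k * x k ^ 2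
  ctr : ∀ i x v, ∑ k, (σ k)⁻¹ * (S.A i *ᵥ x + S.B i *ᵥ v) k ^ 2 ≤
    ∑ k, (σ k)⁻¹ * x k ^ 2 + v ⬝ᵥ v

section Truncation

variable (S : LSS D (n + 1) m p) (i : Fin D) (x : Fin n → ℝ) (v : Fin m → ℝ)

theorem truncate_A_mulVec (j : Fin n) :
    ((S.truncate n n.le_succ).A i *ᵥ x) j = (S.A i *ᵥ Fin.snoc x 0) j.castSucc := by
  simp [mulVec, dotProduct, Fin.sum_univ_castSucc, truncate]
  rfl

theorem truncate_B_mulVec (j : Fin n) :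
    ((S.truncate n n.le_succ).B i *ᵥ v) j = (S.B i *ᵥ v) j.castSucc := by
  simp [mulVec, dotProduct, truncate]
  rfl

theorem truncate_C_mulVec :
    (S.truncate n n.le_succ).C i *ᵥ x = S.C i *ᵥ (Fin.snoc x 0 : Fin (n + 1) → ℝ) := by
  ext j
  simp [mulVec, dotProduct, Fin.sum_univ_castSucc, truncate]
  rfl

/-- The vector field of the truncation is that of the full system with the last component
suppressed. -/
theorem snoc_truncate :
    (Fin.snoc ((S.truncate n n.le_succ).A i *ᵥ x + (S.truncate n n.le_succ).B i *ᵥ v) 0 :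
      Fin (n + 1) → ℝ) =
      Function.update (S.A i *ᵥ Fin.snoc x 0 + S.B i *ᵥ v) (Fin.last n) 0 := by
  ext k
  refine Fin.lastCases ?_ (fun j => ?_) k
  · simp
  · rw [Function.update_of_ne (Fin.castSucc_lt_last j).ne]
    simp [truncate_A_mulVec, truncate_B_mulVec]

end Truncation

/-- On states whose last component is zero, the last term of each weighted sum vanishes, so the
inequalities restrict directly. -/
theorem IsContBalanced.truncate {S : LSS D (n + 1) m p} {σ : Fin (n + 1) → ℝ}
    (h : S.IsContBalanced σ) :
    (S.truncate n n.le_succ).IsContBalanced (σ ∘ Fin.castSucc) where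
  pos k := h.pos _
  obs i x := by
    simpa [Fin.sum_univ_castSucc, truncate_A_mulVec, truncate_C_mulVec] using
      h.obs i (Fin.snoc x 0)
  ctr i x v := by
    simpa [Fin.sum_univ_castSucc, truncate_A_mulVec, truncate_B_mulVec] using
      h.ctr i (Fin.snoc x 0) v

/-- The next state may have a nonzero last component, but it enters through a nonnegative square on
the smaller side, which can be dropped. -/
theorem IsDiscBalanced.truncate {S : LSS D (n + 1) m p} {σ : Fin (n + 1) → ℝ}
    (h : S.IsDiscBalanced σ) :
    (S.truncate n n.le_succ).IsDiscBalanced (σ ∘ Fin.castSucc) where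
  pos k := h.pos _
  obs i x := by
    have h1 := h.obs i (Fin.snoc x 0)
    have h2 := mul_nonneg (h.pos (Fin.last n)).le
      (sq_nonneg ((S.A i *ᵥ (Fin.snoc x 0 : Fin (n + 1) → ℝ)) (Fin.last n)))
    simp only [Fin.sum_univ_castSucc, Fin.snoc_castSucc, Fin.snoc_last] at h1
    simp only [truncate_A_mulVec, truncate_C_mulVec, Function.comp_apply]
    linarith
  ctr i x v := by
    have h1 := h.ctr i (Fin.snoc x 0) v
    have h2 := mul_nonneg (inv_pos.2 (h.pos (Fin.last n))).le
      (sq_nonneg ((S.A i *ᵥ (Fin.snoc x 0 : Fin (n + 1) → ℝ) + S.B i *ᵥ v) (Fin.last n)))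
    simp only [Fin.sum_univ_castSucc, Fin.snoc_castSucc, Fin.snoc_last, Pi.add_apply] at h1 h2
    simp only [Pi.add_apply, truncate_A_mulVec, truncate_B_mulVec, Function.comp_apply]
    linarith

/-- The storage function for the difference between a state `x` and a state `X` of the system
whose `l`-th component is suppressed. -/
noncomputable def storage (σ : Fin n → ℝ) (l : Fin n) (x X : Fin n → ℝ) : ℝ :=
  ∑ k, σ k * (x k - X k) ^ 2 + σ l ^ 2 * ∑ k, (σ k)⁻¹ * (x k + X k) ^ 2

theorem storage_nonneg {σ : Fin n → ℝ} (hσ : ∀ k, 0 < σ k) (l : Fin n) (x X : Fin n → ℝ) :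
    0 ≤ storage σ l x X := by
  refine add_nonneg (Finset.sum_nonneg fun k _ => ?_)
    (mul_nonneg (sq_nonneg _) (Finset.sum_nonneg fun k _ => ?_))
  · exact mul_nonneg (hσ k).le (sq_nonneg _)
  · exact mul_nonneg (inv_pos.2 (hσ k)).le (sq_nonneg _)

/-- The left side is the derivative of `storage` when `x` and `X` move with velocities `g` and `f`.
Its bound is the observability inequality at `x - X` plus `σ l ^ 2` times the controllability
inequality at `x + X`. -/
theorem IsContBalanced.storage_rate_le {S : LSS D n m p} {σ : Fin n → ℝ} (h : S.IsContBalanced σ)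
    (i : Fin D) (l : Fin n) (x X g f : Fin n → ℝ) (v : Fin m → ℝ) (hX : X l = 0)
    (hg : g = S.A i *ᵥ x + S.B i *ᵥ v)
    (hf : f = Function.update (S.A i *ᵥ X + S.B i *ᵥ v) l 0) :
    ∑ k, σ k * (2 * ((x k - X k) * (g k - f k))) +
        σ l ^ 2 * ∑ k, (σ k)⁻¹ * (2 * ((x k + X k) * (g k + f k))) ≤
      4 * σ l ^ 2 * (v ⬝ᵥ v) - (S.C i *ᵥ x - S.C i *ᵥ X) ⬝ᵥ (S.C i *ᵥ x - S.C i *ᵥ X) := by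
  set w := (S.A i *ᵥ X + S.B i *ᵥ v) l with hw
  have hfk : ∀ k, f k = (S.A i *ᵥ X + S.B i *ᵥ v) k - if k = l then w else 0 := by
    intro k
    by_cases hk : k = l
    · subst hk; simp [hf, hw]
    · simp [hf, hk]
  have h1 := h.obs i (x - X)
  -- Both states are driven by `v`, so their sum is driven by `2v`; this is the source of the factor
  -- 4, hence of the 2 in the error bound.
  have h2 := h.ctr i (x + X) ((2 : ℝ) • v)
  have e1 : ∑ k, σ k * (2 * ((x k - X k) * (g k - f k))) =
      2 * (∑ k, σ k * ((x - X) k * (S.A i *ᵥ (x - X)) k)) + 2 * (σ l * (x l * w)) := by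
    have : ∀ k, σ k * (2 * ((x k - X k) * (g k - f k))) =
        2 * (σ k * ((x - X) k * (S.A i *ᵥ (x - X)) k)) +
          if k = l then 2 * (σ k * ((x k - X k) * w)) else 0 := by
      intro k
      rw [hfk, hg]
      split_ifs <;> simp [mulVec_sub] <;> ring
    simp only [this, Finset.sum_add_distrib, ← Finset.mul_sum]
    simp [hX]
  have e2 : ∑ k, (σ k)⁻¹ * (2 * ((x k + X k) * (g k + f k))) =
      2 * (∑ k, (σ k)⁻¹ * ((x + X) k * (S.A i *ᵥ (x + X) + S.B i *ᵥ ((2 : ℝ) • v)) k)) -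
        2 * ((σ l)⁻¹ * (x l * w)) := by
    have : ∀ k, (σ k)⁻¹ * (2 * ((x k + X k) * (g k + f k))) =
        2 * ((σ k)⁻¹ * ((x + X) k * (S.A i *ᵥ (x + X) + S.B i *ᵥ ((2 : ℝ) • v)) k)) -
          if k = l then 2 * ((σ k)⁻¹ * ((x k + X k) * w)) else 0 := by
      intro k
      rw [hfk, hg]
      split_ifs <;> simp [mulVec_add, mulVec_smul] <;> ring
    simp only [this, Finset.sum_sub_distrib, ← Finset.mul_sum]
    simp [hX]
  -- The weight `σ l ^ 2` makes the defect terms of `e1` and `e2` cancel exactly.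
  have e3 : σ l ^ 2 * (2 * ((σ l)⁻¹ * (x l * w))) = 2 * (σ l * (x l * w)) := by
    field_simp [(h.pos l).ne']
  have h3 := mul_le_mul_of_nonneg_left h2 (sq_nonneg (σ l))
  have e4 : ((2 : ℝ) • v) ⬝ᵥ ((2 : ℝ) • v) = 4 * (v ⬝ᵥ v) := by
    simp; ring
  rw [e4] at h3
  rw [e1, e2, mul_sub, e3, ← mulVec_sub (S.C i)]
  linarith

/-- The same combination in discrete time. Suppressing `w` changes squares rather than products, and
the defect terms add up to `-2 σ_l w²`. -/
theorem IsDiscBalanced.storage_le {S : LSS D n m p} {σ : Fin n → ℝ} (h : S.IsDiscBalanced σ)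
    (i : Fin D) (l : Fin n) (x X g f : Fin n → ℝ) (v : Fin m → ℝ)
    (hg : g = S.A i *ᵥ x + S.B i *ᵥ v)
    (hf : f = Function.update (S.A i *ᵥ X + S.B i *ᵥ v) l 0) :
    storage σ l g f ≤ storage σ l x X +
      (4 * σ l ^ 2 * (v ⬝ᵥ v) - (S.C i *ᵥ x - S.C i *ᵥ X) ⬝ᵥ (S.C i *ᵥ x - S.C i *ᵥ X)) := by
  set w := (S.A i *ᵥ X + S.B i *ᵥ v) l with hw
  have hfk : ∀ k, f k = (S.A i *ᵥ X + S.B i *ᵥ v) k - if k = l then w else 0 := by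
    intro k
    by_cases hk : k = l
    · subst hk; simp [hf, hw]
    · simp [hf, hk]
  have h1 := h.obs i (x - X)
  have h2 := h.ctr i (x + X) ((2 : ℝ) • v)
  have e1 : ∑ k, σ k * (g k - f k) ^ 2 =
      ∑ k, σ k * (S.A i *ᵥ (x - X)) k ^ 2 + σ l * (2 * ((g l - w) * w) + w ^ 2) := by
    have : ∀ k, σ k * (g k - f k) ^ 2 = σ k * (S.A i *ᵥ (x - X)) k ^ 2 +
          if k = l then σ k * (2 * ((g k - w) * w) + w ^ 2) else 0 := by
      intro k
      rw [hfk]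
      split_ifs with hk
      · subst hk
        simp [hg, hw, mulVec_sub]; ring
      · simp [hg, mulVec_sub]
    simp [this, Finset.sum_add_distrib]
  have e2 : ∑ k, (σ k)⁻¹ * (g k + f k) ^ 2 =
      ∑ k, (σ k)⁻¹ * (S.A i *ᵥ (x + X) + S.B i *ᵥ ((2 : ℝ) • v)) k ^ 2 -
        (σ l)⁻¹ * (2 * ((g l + w) * w) - w ^ 2) := by
    have : ∀ k, (σ k)⁻¹ * (g k + f k) ^ 2 =
        (σ k)⁻¹ * (S.A i *ᵥ (x + X) + S.B i *ᵥ ((2 : ℝ) • v)) k ^ 2 -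
          if k = l then (σ k)⁻¹ * (2 * ((g k + w) * w) - w ^ 2) else 0 := by
      intro k
      rw [hfk]
      split_ifs with hk
      · subst hk
        simp [hg, hw, mulVec_add, mulVec_smul]; ring
      · simp [hg, mulVec_add, mulVec_smul]; ring_nf; simp
    simp [this, Finset.sum_sub_distrib]
  have e3 : σ l ^ 2 * ((σ l)⁻¹ * (2 * ((g l + w) * w) - w ^ 2)) =
      σ l * (2 * ((g l + w) * w) - w ^ 2) := by
    field_simp [(h.pos l).ne']
  have h3 := mul_le_mul_of_nonneg_left h2 (sq_nonneg (σ l))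
  have e4 : ((2 : ℝ) • v) ⬝ᵥ ((2 : ℝ) • v) = 4 * (v ⬝ᵥ v) := by
    simp; ring
  have h4 : 0 ≤ σ l * w ^ 2 := mul_nonneg (h.pos l).le (sq_nonneg w)
  rw [e4] at h3
  simp only [Pi.sub_apply, Pi.add_apply] at h1 h3 e2
  rw [storage, storage, e1, e2, mul_sub, e3, ← mulVec_sub (S.C i)]
  nlinarith

end LSS

/-! ### From dissipation inequalities to `L₂` bounds -/

/-- An `L₂` bound from bounds on an exhausting sequence of sets. -/
theorem memLp_two_and_eLpNorm_le_of_aecover {T E F : Type*} [MeasurableSpace T] {μ : Measure T}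
    [NormedAddCommGroup E] [NormedAddCommGroup F] {φ : ℕ → Set T} (hφ : AECover μ atTop φ)
    {e : T → E} {u : T → F} (he : AEStronglyMeasurable e μ) (hu : MemLp u 2 μ) {c : ℝ}
    (hc : 0 ≤ c) (hint : ∀ k, IntegrableOn (fun t => ‖e t‖ ^ 2) (φ k) μ)
    (hle : ∀ k, ∫ t in φ k, ‖e t‖ ^ 2 ∂μ ≤ ∫ t in φ k, c ^ 2 * ‖u t‖ ^ 2 ∂μ) :
    MemLp e 2 μ ∧ eLpNorm e 2 μ ≤ ENNReal.ofReal c * eLpNorm u 2 μ := by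
  have hu2 := (memLp_two_iff_integrable_sq_norm hu.1).1 hu
  have hb : ∀ k, ∫ t in φ k, ‖e t‖ ^ 2 ∂μ ≤ c ^ 2 * ∫ t, ‖u t‖ ^ 2 ∂μ := fun k => by
    rw [← integral_const_mul]
    exact (hle k).trans (setIntegral_le_integral (hu2.const_mul _)
      (ae_of_all _ fun t => mul_nonneg (sq_nonneg _) (sq_nonneg _)))
  -- The bound is uniform in `k`, so square-integrability of the error is a consequence, not an
  -- assumption.
  have he2 : Integrable (fun t => ‖e t‖ ^ 2) μ :=
    hφ.integrable_of_integral_bounded_of_nonneg_ae _ hint (ae_of_all _ fun t => sq_nonneg _)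
      (Eventually.of_forall hb)
  have hmem : MemLp e 2 μ := (memLp_two_iff_integrable_sq_norm he).2 he2
  have hI : ∫ t, ‖e t‖ ^ 2 ∂μ ≤ c ^ 2 * ∫ t, ‖u t‖ ^ 2 ∂μ :=
    le_of_tendsto (hφ.integral_tendsto_of_countably_generated he2) (Eventually.of_forall hb)
  refine ⟨hmem, ?_⟩
  rw [hmem.eLpNorm_eq_integral_rpow_norm two_ne_zero ENNReal.ofNat_ne_top,
    hu.eLpNorm_eq_integral_rpow_norm two_ne_zero ENNReal.ofNat_ne_top, ← ENNReal.ofReal_mul hc]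
  refine ENNReal.ofReal_le_ofReal ?_
  simp only [ENNReal.toReal_ofNat, Real.rpow_two]
  rw [← one_div, ← Real.sqrt_eq_rpow, ← Real.sqrt_eq_rpow]
  calc √(∫ t, ‖e t‖ ^ 2 ∂μ) ≤ √(c ^ 2 * ∫ t, ‖u t‖ ^ 2 ∂μ) := Real.sqrt_le_sqrt hI
    _ = c * √(∫ t, ‖u t‖ ^ 2 ∂μ) := by
      rw [Real.sqrt_mul (sq_nonneg c), Real.sqrt_sq hc]

theorem _root_.EuclideanSpace.real_norm_sq_eq_dotProduct {ι : Type*} [Fintype ι]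
    (x : EuclideanSpace ℝ ι) : ‖x‖ ^ 2 = x.ofLp ⬝ᵥ x.ofLp := by
  rw [EuclideanSpace.real_norm_sq_eq]
  simp [dotProduct, sq]

/-- The integral of an upper bound for the derivative of an absolutely continuous function. -/
theorem _root_.AbsolutelyContinuousOnInterval.integral_le_of_add_deriv_le {V V' f g : ℝ → ℝ}
    {T : ℝ} (hT : 0 ≤ T) (hV : AbsolutelyContinuousOnInterval V 0 T)
    (hV' : ∀ᵐ t ∂contTime, HasDerivAt V (V' t) t) (h0 : V 0 ≤ V T)
    (hf : AEStronglyMeasurable f contTime) (hf0 : ∀ t, 0 ≤ f t) (hg : IntegrableOn g (Ioc 0 T))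
    (hle : ∀ t, V' t ≤ g t - f t) :
    IntegrableOn f (Ioc 0 T) ∧ ∫ t in Ioc 0 T, f t ≤ ∫ t in Ioc 0 T, g t := by
  have hsub : Ioc 0 T ⊆ Ici (0 : ℝ) := fun t ht => ht.1.le
  have hd : ∀ᵐ t ∂(volume.restrict (Ioc 0 T)), f t ≤ g t - deriv V t := by
    filter_upwards [ae_restrict_of_ae_restrict_of_subset hsub hV'] with t ht
    rw [ht.deriv]
    linarith [hle t]
  have hdi : IntegrableOn (deriv V) (Ioc 0 T) :=
    (intervalIntegrable_iff_integrableOn_Ioc_of_le hT).1 hV.intervalIntegrable_deriv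
  -- The nonnegative `f` is dominated by `g - V'`, and the derivative of an absolutely continuous
  -- function is integrable.
  have hfi : IntegrableOn f (Ioc 0 T) := by
    refine (hg.sub hdi).mono' (hf.mono_measure (Measure.restrict_mono_set _ hsub)) ?_
    filter_upwards [hd] with t ht
    rwa [Real.norm_of_nonneg (hf0 t)]
  refine ⟨hfi, (integral_mono_ae hfi (hg.sub hdi) hd).trans ?_⟩
  have h1 := hV.integral_deriv_eq_sub
  rw [intervalIntegral.integral_of_le hT] at h1
  have h2 := integral_sub hg hdi
  simp only [Pi.sub_apply]
  rw [h2, h1]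
  linarith

theorem _root_.AbsolutelyContinuousOnInterval.fun_sum {ι : Type*} (s : Finset ι) {f : ι → ℝ → ℝ}
    {a b : ℝ} (h : ∀ i ∈ s, AbsolutelyContinuousOnInterval (f i) a b) :
    AbsolutelyContinuousOnInterval (fun t => ∑ i ∈ s, f i t) a b := by
  classical
  induction s using Finset.induction_on with
  | empty =>
    simpa using (LipschitzWith.const (0 : ℝ)).lipschitzOnWith.absolutelyContinuousOnInterval
  | insert i s hi ih =>
    simp only [Finset.sum_insert hi]
    exact (h i (Finset.mem_insert_self i s)).fun_add
      (ih fun j hj => h j (Finset.mem_insert_of_mem hj))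

theorem _root_.AbsolutelyContinuousOnInterval.continuousLinearMap_comp {E F : Type*}
    [NormedAddCommGroup E] [NormedSpace ℝ E] [NormedAddCommGroup F] [NormedSpace ℝ F]
    (L : E →L[ℝ] F) {f : ℝ → E} {a b : ℝ} (h : AbsolutelyContinuousOnInterval f a b) :
    AbsolutelyContinuousOnInterval (fun t => L (f t)) a b := by
  rw [absolutelyContinuousOnInterval_iff] at h ⊢
  intro ε hε
  -- The `+ 1` keeps the divisor positive when `L = 0`.
  obtain ⟨δ, hδ, H⟩ := h (ε / (‖L‖ + 1)) (by positivity)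
  refine ⟨δ, hδ, fun I hI hlt => ?_⟩
  have h1 := H I hI hlt
  rw [lt_div_iff₀ (by positivity), mul_comm, Finset.mul_sum] at h1
  refine lt_of_le_of_lt (Finset.sum_le_sum fun i _ => ?_) h1
  rw [dist_eq_norm, dist_eq_norm, ← map_sub]
  refine (L.le_opNorm _).trans ?_
  gcongr
  linarith

/-! ### Removing one state -/

namespace LSS

variable {D n m p : ℕ}

theorem storage_absolutelyContinuous (σ : Fin n → ℝ) (l : Fin n) {x X : ℝ → Fin n → ℝ} {a b : ℝ}
    (hx : ∀ k, AbsolutelyContinuousOnInterval (fun t => x t k) a b)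
    (hX : ∀ k, AbsolutelyContinuousOnInterval (fun t => X t k) a b) :
    AbsolutelyContinuousOnInterval (fun t => storage σ l (x t) (X t)) a b := by
  simp only [storage, sq (_ - _), sq (_ + _)]
  refine AbsolutelyContinuousOnInterval.fun_add ?_ (.const_mul _ ?_)
  · exact .fun_sum _ fun k _ => .const_mul _ (((hx k).fun_sub (hX k)).fun_mul
      ((hx k).fun_sub (hX k)))
  · exact .fun_sum _ fun k _ => .const_mul _ (((hx k).fun_add (hX k)).fun_mul
      ((hx k).fun_add (hX k)))

theorem storage_hasDerivAt (σ : Fin n → ℝ) (l : Fin n) {x X : ℝ → Fin n → ℝ} {g f : Fin n → ℝ}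
    {t : ℝ} (hx : ∀ k, HasDerivAt (fun t => x t k) (g k) t)
    (hX : ∀ k, HasDerivAt (fun t => X t k) (f k) t) :
    HasDerivAt (fun t => storage σ l (x t) (X t))
      (∑ k, σ k * (2 * ((x t k - X t k) * (g k - f k))) +
        σ l ^ 2 * ∑ k, (σ k)⁻¹ * (2 * ((x t k + X t k) * (g k + f k)))) t := by
  have h1 : ∀ {y : ℝ → ℝ} {y' : ℝ}, HasDerivAt y y' t →
      HasDerivAt (fun t => y t ^ 2) (2 * (y t * y')) t := fun h => by
    simpa [mul_assoc] using h.fun_pow 2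
  exact (HasDerivAt.fun_sum fun k _ => (h1 ((hx k).fun_sub (hX k))).const_mul (σ k)).fun_add
    ((HasDerivAt.fun_sum fun k _ => (h1 ((hx k).fun_add (hX k))).const_mul (σ k)⁻¹).const_mul
      (σ l ^ 2))

theorem IsContTrajectory.continuousOn {S : LSS D n m p} {x₀ : EuclideanSpace ℝ (Fin n)}
    {u : L2Signal contTime m} {q : ContSwitching D} {x : ℝ → EuclideanSpace ℝ (Fin n)}
    (h : S.IsContTrajectory x₀ u q x) : ContinuousOn x (Ici 0) := by
  intro t ht
  -- An interval reaching past `t` is a neighbourhood of `t` in `[0, ∞)`.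
  have h1 : 0 ≤ t + 1 := by linarith [mem_Ici.1 ht]
  have h2 := (h.absolutelyContinuous (t + 1) h1).continuousOn
  rw [uIcc_of_le h1] at h2
  refine (h2 t ⟨ht, by linarith⟩).mono_of_mem_nhdsWithin ?_
  exact inter_mem_nhdsWithin (Ici 0) (Iic_mem_nhds (by linarith))

theorem aestronglyMeasurable_switched_apply {E F : Type} [NormedAddCommGroup E]
    [NormedSpace ℝ E] [NormedAddCommGroup F] [NormedSpace ℝ F] (L : Fin D → E →L[ℝ] F)
    (q : ContSwitching D) {x : ℝ → E} (hx : ContinuousOn x (Ici 0)) :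
    AEStronglyMeasurable (fun t => L (q.1 t) (x t)) contTime :=
  (ContinuousLinearMap.id ℝ _).aestronglyMeasurable_comp₂
    ((continuous_of_discreteTopology (f := L)).comp_aestronglyMeasurable
      (aestronglyMeasurable_switching q))
    (hx.aestronglyMeasurable measurableSet_Ici)

theorem IsContTrajectory.aestronglyMeasurable_output {S : LSS D n m p}
    {x₀ : EuclideanSpace ℝ (Fin n)} {u : L2Signal contTime m} {q : ContSwitching D}
    {x : ℝ → EuclideanSpace ℝ (Fin n)} (h : S.IsContTrajectory x₀ u q x) :
    AEStronglyMeasurable (fun t => (S.C (q.1 t)).toEuclideanLin (x t)) contTime := by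
  exact aestronglyMeasurable_switched_apply
    (fun i => (S.C i).toEuclideanLin.toContinuousLinearMap) q h.continuousOn

/-- The error bound for the removal of one state from a balanced system, in continuous time. -/
theorem IsContBalanced.output_sub_truncate {S : LSS D (n + 1) m p} {σ : Fin (n + 1) → ℝ}
    (h : S.IsContBalanced σ) {u : L2Signal contTime m} {q : ContSwitching D}
    {x : ℝ → EuclideanSpace ℝ (Fin (n + 1))} {x' : ℝ → EuclideanSpace ℝ (Fin n)}
    (hx : S.IsContTrajectory 0 u q x)
    (hx' : (S.truncate n n.le_succ).IsContTrajectory 0 u q x') :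
    MemLp (fun t => (S.C (q.1 t)).toEuclideanLin (x t) -
        ((S.truncate n n.le_succ).C (q.1 t)).toEuclideanLin (x' t)) 2 contTime ∧
      eLpNorm (fun t => (S.C (q.1 t)).toEuclideanLin (x t) -
        ((S.truncate n n.le_succ).C (q.1 t)).toEuclideanLin (x' t)) 2 contTime ≤
        ENNReal.ofReal (2 * σ (Fin.last n)) * eLpNorm u.1 2 contTime := by
  set S' := S.truncate n n.le_succ
  set l := Fin.last n
  set e : ℝ → EuclideanSpace ℝ (Fin p) := fun t =>
    (S.C (q.1 t)).toEuclideanLin (x t) - (S'.C (q.1 t)).toEuclideanLin (x' t) with he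
  have hem : AEStronglyMeasurable e contTime :=
    hx.aestronglyMeasurable_output.sub hx'.aestronglyMeasurable_output
  let X : ℝ → Fin (n + 1) → ℝ := fun t => Fin.snoc (x' t).ofLp 0
  let g : ℝ → Fin (n + 1) → ℝ := fun t => S.A (q.1 t) *ᵥ (x t).ofLp + S.B (q.1 t) *ᵥ (u.1 t).ofLp
  let f : ℝ → Fin (n + 1) → ℝ := fun t =>
    Function.update (S.A (q.1 t) *ᵥ X t + S.B (q.1 t) *ᵥ (u.1 t).ofLp) l 0
  let V : ℝ → ℝ := fun t => storage σ l (x t).ofLp (X t)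
  have hV : ∀ T, 0 ≤ T → AbsolutelyContinuousOnInterval V 0 T := by
    intro T hT
    refine storage_absolutelyContinuous σ l (fun k => ?_) (fun k => ?_)
    · exact (hx.absolutelyContinuous T hT).continuousLinearMap_comp
        (EuclideanSpace.proj k : EuclideanSpace ℝ (Fin (n + 1)) →L[ℝ] ℝ)
    · refine Fin.lastCases ?_ (fun j => ?_) k
      · simpa [X] using
          (LipschitzWith.const (0 : ℝ)).lipschitzOnWith.absolutelyContinuousOnInterval
      · simpa [X] using (hx'.absolutelyContinuous T hT).continuousLinearMap_comp
          (EuclideanSpace.proj j : EuclideanSpace ℝ (Fin n) →L[ℝ] ℝ)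
  let V' : ℝ → ℝ := fun t =>
    ∑ k, σ k * (2 * (((x t).ofLp k - X t k) * (g t k - f t k))) +
      σ l ^ 2 * ∑ k, (σ k)⁻¹ * (2 * (((x t).ofLp k + X t k) * (g t k + f t k)))
  have hV' : ∀ᵐ t ∂contTime, HasDerivAt V (V' t) t := by
    filter_upwards [hx.hasDerivAt, hx'.hasDerivAt] with t ht ht'
    refine storage_hasDerivAt σ l (g := g t) (f := f t) (fun k => ?_) (fun k => ?_)
    · exact ((EuclideanSpace.proj k :
        EuclideanSpace ℝ (Fin (n + 1)) →L[ℝ] ℝ).hasFDerivAt.comp_hasDerivAt t ht)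
    -- The padded truncated state moves with the full vector field whose last component is set to
    -- zero.
    · have hf : f t = Fin.snoc _ 0 := (snoc_truncate S (q.1 t) (x' t).ofLp (u.1 t).ofLp).symm
      rw [hf]
      refine Fin.lastCases ?_ (fun j => ?_) k
      · simpa [X] using hasDerivAt_const t (0 : ℝ)
      · simp only [X, Fin.snoc_castSucc]
        exact ((EuclideanSpace.proj j :
          EuclideanSpace ℝ (Fin n) →L[ℝ] ℝ).hasFDerivAt.comp_hasDerivAt t ht')
  have hV0 : V 0 = 0 := by
    have hX0 : X 0 = 0 := by
      ext k
      refine Fin.lastCases ?_ (fun j => ?_) k <;> simp [X, hx'.initial]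
    simp only [V, hX0, hx.initial]
    simp [storage]
  have hu2 : Integrable (fun t => (2 * σ l) ^ 2 * ‖u.1 t‖ ^ 2) contTime :=
    ((memLp_two_iff_integrable_sq_norm u.2.1).1 u.2).const_mul _
  have key : ∀ k : ℕ, IntegrableOn (fun t => ‖e t‖ ^ 2) (Ioc 0 (k : ℝ)) ∧
      ∫ t in Ioc 0 (k : ℝ), ‖e t‖ ^ 2 ≤ ∫ t in Ioc 0 (k : ℝ), (2 * σ l) ^ 2 * ‖u.1 t‖ ^ 2 := by
    intro k
    refine (hV k k.cast_nonneg).integral_le_of_add_deriv_le k.cast_nonneg hV'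
      (by rw [hV0]; exact storage_nonneg h.pos _ _ _) (hem.norm.pow 2) (fun t => sq_nonneg _)
      (hu2.mono_measure (Measure.restrict_mono_set _ fun t ht => ht.1.le)) fun t => ?_
    refine (h.storage_rate_le (q.1 t) l _ _ _ _ (u.1 t).ofLp (by simp [X, l]) rfl rfl).trans
      (le_of_eq ?_)
    rw [EuclideanSpace.real_norm_sq_eq_dotProduct, EuclideanSpace.real_norm_sq_eq_dotProduct]
    simp only [he, WithLp.ofLp_sub, ofLp_toLpLin, toLin'_apply]
    rw [truncate_C_mulVec]
    ring
  -- `contTime` already lives on `[0, ∞)`, so the half-lines `Iic k` exhaust it, and the endpoint 0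
  -- is a null set.
  have hrestrict : ∀ k : ℕ, contTime.restrict (Iic (k : ℝ)) = volume.restrict (Ioc 0 (k : ℝ)) := by
    intro k
    rw [contTime, Measure.restrict_restrict measurableSet_Iic, inter_comm, Ici_inter_Iic,
      restrict_Ioc_eq_restrict_Icc]
  refine memLp_two_and_eLpNorm_le_of_aecover
    (aecover_Iic (b := fun k : ℕ => (k : ℝ)) tendsto_natCast_atTop_atTop) hem u.2
    (mul_nonneg two_pos.le (h.pos l).le) (fun k => ?_) fun k => ?_
  · rw [IntegrableOn, hrestrict]
    exact (key k).1
  · rw [hrestrict]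
    exact (key k).2

/-- The error bound for the removal of one state from a balanced system, in discrete time. -/
theorem IsDiscBalanced.output_sub_truncate {S : LSS D (n + 1) m p} {σ : Fin (n + 1) → ℝ}
    (h : S.IsDiscBalanced σ) (u : L2Signal discTime m) (q : DiscSwitching D) :
    MemLp (S.discOutput u q - (S.truncate n n.le_succ).discOutput u q) 2 discTime ∧
      eLpNorm (S.discOutput u q - (S.truncate n n.le_succ).discOutput u q) 2 discTime ≤
        ENNReal.ofReal (2 * σ (Fin.last n)) * eLpNorm u.1 2 discTime := by
  set S' := S.truncate n n.le_succ
  set l := Fin.last n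
  set e := S.discOutput u q - S'.discOutput u q with he
  let X : ℕ → Fin (n + 1) → ℝ := fun t => Fin.snoc (S'.discState 0 u q t).ofLp 0
  let V : ℕ → ℝ := fun t => storage σ l (S.discState 0 u q t).ofLp (X t)
  have hV0 : V 0 = 0 := by
    have hX0 : X 0 = 0 := by
      ext k
      refine Fin.lastCases ?_ (fun j => ?_) k <;> simp [X, discState]
    simp only [V, hX0, discState]
    simp [storage]
  have hV : ∀ t, V (t + 1) ≤ V t + ((2 * σ l) ^ 2 * ‖u.1 t‖ ^ 2 - ‖e t‖ ^ 2) := by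
    intro t
    refine (h.storage_le (q t) l (S.discState 0 u q t).ofLp (X t) _ _ (u.1 t).ofLp ?_ ?_).trans
      (le_of_eq ?_)
    · simp [discState]
    · refine Eq.trans ?_ (snoc_truncate S (q t) _ (u.1 t).ofLp)
      simp [X, discState, S']
    · rw [EuclideanSpace.real_norm_sq_eq_dotProduct, EuclideanSpace.real_norm_sq_eq_dotProduct]
      simp only [he, V, discOutput, Pi.sub_apply, WithLp.ofLp_sub, ofLp_toLpLin, toLin'_apply]
      rw [truncate_C_mulVec]
      ring
  -- The one-step inequality telescopes from `V 0 = 0`; the term `V k ≥ 0` is discarded at the end.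
  have key : ∀ k, V k + ∑ t ∈ Finset.range k, ‖e t‖ ^ 2 ≤
      ∑ t ∈ Finset.range k, (2 * σ l) ^ 2 * ‖u.1 t‖ ^ 2 := by
    intro k
    induction k with
    | zero => simp [hV0]
    | succ k ih =>
      rw [Finset.sum_range_succ, Finset.sum_range_succ]
      linarith [hV k]
  have hcover : AECover discTime atTop fun k : ℕ => (Finset.range k : Set ℕ) :=
    ⟨ae_of_all _ fun t => (eventually_gt_atTop t).mono fun k hk => by simpa using hk,
      fun k => (Finset.range k).measurableSet⟩
  have hfin : ∀ (f : ℕ → ℝ) (k : ℕ), IntegrableOn f (Finset.range k : Set ℕ) discTime :=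
    fun f k => by
    rw [← (Finset.range k : Set ℕ).biUnion_of_singleton]
    exact integrableOn_finset_iUnion.2 fun t _ => integrableOn_singleton
      (hx := by simp [discTime])
  have hsum : ∀ (f : ℕ → ℝ) (k : ℕ),
      ∫ t in (Finset.range k : Set ℕ), f t ∂discTime = ∑ t ∈ Finset.range k, f t := by
    intro f k
    rw [setIntegral_finset _ (hfin f k)]
    simp
  refine memLp_two_and_eLpNorm_le_of_aecover hcover
    (measurable_from_top (f := e)).aestronglyMeasurable u.2
    (mul_nonneg two_pos.le (h.pos l).le) (fun k => hfin _ k) fun k => ?_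
  rw [hsum, hsum]
  exact le_trans (le_add_of_nonneg_left (storage_nonneg h.pos _ _ _)) (key k)

/-! ### Removing several states -/

/-- An error bound for the removal of single states adds up to an error bound for the removal of
several states. Here `Out S y` says that `y` is an output of `S`. -/
theorem output_sub_truncate_of_step {T : Type} [MeasurableSpace T] {μ : Measure T} (N : ℝ≥0∞)
    (Bal : ∀ n, LSS D n m p → (Fin n → ℝ) → Prop)
    (Out : ∀ n, LSS D n m p → (T → EuclideanSpace ℝ (Fin p)) → Prop)
    (hpos : ∀ n S σ, Bal n S σ → ∀ k, 0 < σ k) (hex : ∀ n S, ∃ y, Out n S y)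
    (htr : ∀ n S σ, Bal (n + 1) S σ → Bal n (S.truncate n n.le_succ) (σ ∘ Fin.castSucc))
    (hstep : ∀ n S σ y y', Bal (n + 1) S σ → Out (n + 1) S y → Out n (S.truncate n n.le_succ) y' →
      MemLp (y - y') 2 μ ∧ eLpNorm (y - y') 2 μ ≤ ENNReal.ofReal (2 * σ (Fin.last n)) * N)
    {r n : ℕ} (hr : r < n) (S : LSS D n m p) (σ : Fin n → ℝ) (y y' : T → EuclideanSpace ℝ (Fin p))
    (hS : Bal n S σ) (hy : Out n S y) (hy' : Out r (S.truncate r hr.le) y') :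
    MemLp (y - y') 2 μ ∧ eLpNorm (y - y') 2 μ ≤ ENNReal.ofReal
      (2 * ∑ k ∈ Finset.univ.filter (fun k : Fin n => r ≤ (k : ℕ)), σ k) * N := by
  induction n, hr using Nat.le_induction generalizing y with
  | base =>
    have hsum : ∑ k ∈ Finset.univ.filter (fun k : Fin (r + 1) => r ≤ (k : ℕ)), σ k =
        σ (Fin.last r) := by
      rw [Finset.sum_filter, Fin.sum_univ_castSucc, Finset.sum_eq_zero]
      · simp
      · intro k _
        simp
    rw [hsum]
    exact hstep r S σ y y' hS hy hy'
  | succ n hr ih =>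
    obtain ⟨z, hz⟩ := hex n (S.truncate n n.le_succ)
    obtain ⟨h1, h2⟩ := hstep n S σ y z hS hy hz
    -- Truncating to `n` and then to `r` is definitionally truncating to `r`, so `hy'` fits
    -- unchanged.
    obtain ⟨h3, h4⟩ := ih (S.truncate n n.le_succ) (σ ∘ Fin.castSucc) z (htr n S σ hS) hz hy'
    have hsum : ∑ k ∈ Finset.univ.filter (fun k : Fin (n + 1) => r ≤ (k : ℕ)), σ k =
        ∑ k ∈ Finset.univ.filter (fun k : Fin n => r ≤ (k : ℕ)), (σ ∘ Fin.castSucc) k +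
          σ (Fin.last n) := by
      rw [Finset.sum_filter, Finset.sum_filter, Fin.sum_univ_castSucc]
      simp [(Nat.le_of_succ_le hr : r ≤ n)]
    have hσ := hpos _ _ _ hS
    have hσ' : 0 ≤ ∑ k ∈ Finset.univ.filter (fun k : Fin n => r ≤ (k : ℕ)),
        (σ ∘ Fin.castSucc) k := Finset.sum_nonneg fun k _ => (hσ _).le
    rw [← sub_add_sub_cancel y z y', hsum, mul_add, add_comm (2 * _),
      ENNReal.ofReal_add (by linarith [hσ (Fin.last n)])
        (mul_nonneg two_pos.le hσ'), add_mul]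
    exact ⟨h1.add h3, (eLpNorm_add_le h1.1 h3.1 one_le_two).trans (add_le_add h2 h4)⟩

/-! ### Balancing coordinates, and matrix inequalities as dissipation inequalities -/

section Coordinates

variable {S : LSS D n m p} {P Q R : Matrix (Fin n) (Fin n) ℝ}

theorem changeBasis_A_mul (hR : IsUnit R.det) (i : Fin D) :
    (S.changeBasis R).A i * R = R * S.A i := by
  simp [changeBasis, nonsing_inv_mul_cancel_right _ _ hR]

theorem inv_mul_changeBasis_A (hR : IsUnit R.det) (i : Fin D) :
    R⁻¹ * (S.changeBasis R).A i = S.A i * R⁻¹ := by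
  simp [changeBasis, mul_assoc, nonsing_inv_mul_cancel_left _ _ hR]

/-- Congruence of the original inequality by `R⁻¹`, using the intertwining relation `R⁻¹ (R A R⁻¹) =
A R⁻¹` and its transpose. The controllability versions use congruence by `R` instead. -/
theorem IsContObsGrammian.changeBasis (h : S.IsContObsGrammian Q) (hR : IsUnit R.det) (i : Fin D) :
    (-(((S.changeBasis R).A i)ᵀ * (R⁻¹ᵀ * Q * R⁻¹) + (R⁻¹ᵀ * Q * R⁻¹) * (S.changeBasis R).A i +
      ((S.changeBasis R).C i)ᵀ * (S.changeBasis R).C i)).PosSemidef := by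
  have h1 := (h.2 i).conjTranspose_mul_mul_same R⁻¹
  have e3 : (S.changeBasis R).C i = S.C i * R⁻¹ := rfl
  convert h1 using 1
  have e1 := inv_mul_changeBasis_A (S := S) hR i
  have e2 := congrArg transpose e1
  simp only [transpose_mul] at e2
  simp only [e3, transpose_mul, conjTranspose_eq_transpose_of_trivial, Matrix.mul_neg, Matrix.neg_mul, Matrix.mul_add, Matrix.add_mul,
    Matrix.mul_assoc, e1]
  simp only [← Matrix.mul_assoc, e2]

theorem IsDiscObsGrammian.changeBasis (h : S.IsDiscObsGrammian Q) (hR : IsUnit R.det) (i : Fin D) :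
    (-(((S.changeBasis R).A i)ᵀ * (R⁻¹ᵀ * Q * R⁻¹) * (S.changeBasis R).A i +
      ((S.changeBasis R).C i)ᵀ * (S.changeBasis R).C i - R⁻¹ᵀ * Q * R⁻¹)).PosSemidef := by
  have h1 := (h.2 i).conjTranspose_mul_mul_same R⁻¹
  have e3 : (S.changeBasis R).C i = S.C i * R⁻¹ := rfl
  convert h1 using 1
  have e1 := inv_mul_changeBasis_A (S := S) hR i
  have e2 := congrArg transpose e1
  simp only [transpose_mul] at e2
  simp only [e3, transpose_mul, conjTranspose_eq_transpose_of_trivial, Matrix.mul_neg, Matrix.neg_mul, Matrix.mul_add, Matrix.add_mul, Matrix.mul_sub,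
    Matrix.sub_mul, Matrix.mul_assoc, e1]
  simp only [← Matrix.mul_assoc, e2]

theorem IsContCtrGrammian.changeBasis (h : S.IsContCtrGrammian P) (hR : IsUnit R.det) (i : Fin D) :
    (-((S.changeBasis R).A i * (R * P * Rᵀ) + (R * P * Rᵀ) * ((S.changeBasis R).A i)ᵀ +
      (S.changeBasis R).B i * ((S.changeBasis R).B i)ᵀ)).PosSemidef := by
  have h1 := (h.2 i).mul_mul_conjTranspose_same R
  have e3 : (S.changeBasis R).B i = R * S.B i := rfl
  convert h1 using 1
  have e1 := changeBasis_A_mul (S := S) hR i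
  have e2 := congrArg transpose e1
  simp only [transpose_mul] at e2
  simp only [e3, transpose_mul, conjTranspose_eq_transpose_of_trivial, Matrix.mul_neg, Matrix.neg_mul, Matrix.mul_add, Matrix.add_mul,
    Matrix.mul_assoc, e2]
  simp only [← Matrix.mul_assoc, e1]

theorem IsDiscCtrGrammian.changeBasis (h : S.IsDiscCtrGrammian P) (hR : IsUnit R.det) (i : Fin D) :
    (-((S.changeBasis R).A i * (R * P * Rᵀ) * ((S.changeBasis R).A i)ᵀ +
      (S.changeBasis R).B i * ((S.changeBasis R).B i)ᵀ - R * P * Rᵀ)).PosSemidef := by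
  have h1 := (h.2 i).mul_mul_conjTranspose_same R
  have e3 : (S.changeBasis R).B i = R * S.B i := rfl
  convert h1 using 1
  have e1 := changeBasis_A_mul (S := S) hR i
  have e2 := congrArg transpose e1
  simp only [transpose_mul] at e2
  simp only [e3, transpose_mul, conjTranspose_eq_transpose_of_trivial, Matrix.mul_neg, Matrix.neg_mul, Matrix.mul_add, Matrix.add_mul, Matrix.mul_sub,
    Matrix.sub_mul, Matrix.mul_assoc, e2]
  simp only [← Matrix.mul_assoc, e1]

theorem isUnit_det_balancing {U K : Matrix (Fin n) (Fin n) ℝ} {σ : Fin n → ℝ}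
    (hU : IsUnit U.det) (hK : K ∈ orthogonalGroup (Fin n) ℝ) (hσ : ∀ k, 0 < σ k) :
    IsUnit (diagonal (fun k => √(σ k)) * Kᵀ * U⁻¹).det := by
  have h1 : IsUnit K.det := (isUnit_iff_isUnit_det K).1
    (IsUnit.of_mul_eq_one _ ((mem_orthogonalGroup_iff _ _).1 hK))
  rw [det_mul, det_mul, det_diagonal, det_transpose]
  refine ((IsUnit.mk0 _ ?_).mul h1).mul (isUnit_nonsing_inv_det U hU)
  exact Finset.prod_ne_zero_iff.2 fun k _ => (Real.sqrt_pos.2 (hσ k)).ne'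

/-- Since `R U = Λ^(1/2) Kᵀ`, the factor `U` disappears and orthogonality of `K` leaves `Λ^(1/2)
Λ^(1/2)`. -/
theorem balancing_ctr {U K : Matrix (Fin n) (Fin n) ℝ} {σ : Fin n → ℝ}
    (hU : IsUnit U.det) (hK : K ∈ orthogonalGroup (Fin n) ℝ) (hσ : ∀ k, 0 < σ k)
    (hR : R = diagonal (fun k => √(σ k)) * Kᵀ * U⁻¹) :
    R * (U * Uᵀ) * Rᵀ = diagonal σ := by
  have hK' : Kᵀ * K = 1 := (mem_orthogonalGroup_iff' _ _).1 hK
  have h1 : R * U = diagonal (fun k => √(σ k)) * Kᵀ := by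
    rw [hR, nonsing_inv_mul_cancel_right _ _ hU]
  calc R * (U * Uᵀ) * Rᵀ = (R * U) * (R * U)ᵀ := by simp [mul_assoc]
    _ = diagonal (fun k => √(σ k)) * (Kᵀ * K) * diagonal (fun k => √(σ k)) := by
      rw [h1]; simp [mul_assoc]
    _ = diagonal σ := by
      rw [hK', mul_one, diagonal_mul_diagonal]
      simp [Real.mul_self_sqrt (hσ _).le]

/-- Here `R⁻¹ = U K Λ^(-1/2)`, so the congruence turns `Uᵀ Q U = K Λ² Kᵀ` into `Λ^(-1/2) Λ²
Λ^(-1/2)`. -/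
theorem balancing_obs {U K : Matrix (Fin n) (Fin n) ℝ} {σ : Fin n → ℝ}
    (hU : IsUnit U.det) (hK : K ∈ orthogonalGroup (Fin n) ℝ) (hσ : ∀ k, 0 < σ k)
    (hR : R = diagonal (fun k => √(σ k)) * Kᵀ * U⁻¹)
    (hQ : Uᵀ * Q * U = K * diagonal σ ^ 2 * Kᵀ) :
    R⁻¹ᵀ * Q * R⁻¹ = diagonal σ := by
  have hK' : Kᵀ * K = 1 := (mem_orthogonalGroup_iff' _ _).1 hK
  have hs : ∀ k, √(σ k) ≠ 0 := fun k => (Real.sqrt_pos.2 (hσ k)).ne'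
  have h1 : R⁻¹ = U * K * diagonal (fun k => (√(σ k))⁻¹) := by
    refine inv_eq_right_inv ?_
    calc R * (U * K * diagonal fun k => (√(σ k))⁻¹)
        = diagonal (fun k => √(σ k)) * (Kᵀ * (U⁻¹ * U) * K) * diagonal fun k => (√(σ k))⁻¹ := by
          rw [hR]; simp only [mul_assoc]
      _ = 1 := by
        rw [nonsing_inv_mul _ hU, mul_one, hK', mul_one, diagonal_mul_diagonal]
        simp [hs]
  calc R⁻¹ᵀ * Q * R⁻¹
      = diagonal (fun k => (√(σ k))⁻¹) * (Kᵀ * (Uᵀ * Q * U) * K) *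
          diagonal (fun k => (√(σ k))⁻¹) := by
        rw [h1]; simp [mul_assoc]
    _ = diagonal (fun k => (√(σ k))⁻¹) * ((Kᵀ * K) * diagonal σ ^ 2 * (Kᵀ * K)) *
          diagonal (fun k => (√(σ k))⁻¹) := by
        rw [hQ]; simp only [mul_assoc]
    _ = diagonal σ := by
      rw [hK', one_mul, mul_one, diagonal_pow, diagonal_mul_diagonal, diagonal_mul_diagonal]
      congr 1
      ext k
      have h2 := Real.mul_self_sqrt (hσ k).le
      have h3 := hs k
      simp only [Pi.pow_apply]
      field_simp
      rw [sq (√(σ k)), h2, sq]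

end Coordinates

/-- For controllability, test the matrix inequality at `ξ = Λ⁻¹ x`: it gives `2 ξ·Ax ≤ -|Bᵀξ|²`, and
completing the square `|Bᵀξ - v|² ≥ 0` absorbs the input term. -/
theorem isContBalanced_of_posSemidef {S : LSS D n m p} {σ : Fin n → ℝ} (hσ : ∀ k, 0 < σ k)
    (hobs : ∀ i, (-((S.A i)ᵀ * diagonal σ + diagonal σ * S.A i + (S.C i)ᵀ * S.C i)).PosSemidef)
    (hctr : ∀ i, (-(S.A i * diagonal σ + diagonal σ * (S.A i)ᵀ + S.B i * (S.B i)ᵀ)).PosSemidef) :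
    S.IsContBalanced σ where
  pos := hσ
  obs i x := by
    have h1 := (hobs i).dotProduct_mulVec_nonneg x
    have e1 : x ⬝ᵥ (diagonal σ * S.A i) *ᵥ x = ∑ k, σ k * (x k * (S.A i *ᵥ x) k) := by
      rw [← mulVec_mulVec]
      simp only [dotProduct, mulVec_diagonal]
      exact Finset.sum_congr rfl fun k _ => by ring
    have e2 : x ⬝ᵥ ((S.A i)ᵀ * diagonal σ) *ᵥ x = ∑ k, σ k * (x k * (S.A i *ᵥ x) k) := by
      rw [← mulVec_mulVec, mulVec_transpose, dotProduct_comm, ← dotProduct_mulVec]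
      simp only [dotProduct, mulVec_diagonal]
      exact Finset.sum_congr rfl fun k _ => by ring
    have e3 : x ⬝ᵥ ((S.C i)ᵀ * S.C i) *ᵥ x = S.C i *ᵥ x ⬝ᵥ S.C i *ᵥ x := by
      rw [← mulVec_mulVec, mulVec_transpose, dotProduct_comm, ← dotProduct_mulVec]
    simp only [star_trivial, neg_mulVec, add_mulVec, dotProduct_neg, dotProduct_add, e1, e2, e3]
      at h1
    linarith
  ctr i x v := by
    set ξ : Fin n → ℝ := fun k => (σ k)⁻¹ * x k with hξ
    have hx : diagonal σ *ᵥ ξ = x := by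
      ext k
      rw [mulVec_diagonal, hξ, mul_inv_cancel_left₀ (hσ k).ne']
    have h1 := (hctr i).dotProduct_mulVec_nonneg ξ
    have e1 : ξ ⬝ᵥ (S.A i * diagonal σ) *ᵥ ξ = ξ ⬝ᵥ S.A i *ᵥ x := by
      rw [← mulVec_mulVec, hx]
    have e2 : ξ ⬝ᵥ (diagonal σ * (S.A i)ᵀ) *ᵥ ξ = ξ ⬝ᵥ S.A i *ᵥ x := by
      rw [← mulVec_mulVec, dotProduct_mulVec, ← mulVec_transpose, diagonal_transpose, hx,
        mulVec_transpose, dotProduct_comm, ← dotProduct_mulVec]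
    have e3 : ξ ⬝ᵥ (S.B i * (S.B i)ᵀ) *ᵥ ξ = (S.B i)ᵀ *ᵥ ξ ⬝ᵥ (S.B i)ᵀ *ᵥ ξ := by
      rw [← mulVec_mulVec, dotProduct_mulVec, ← mulVec_transpose]
    have e4 : ∑ k, (σ k)⁻¹ * (x k * (S.A i *ᵥ x + S.B i *ᵥ v) k) =
        ξ ⬝ᵥ S.A i *ᵥ x + (S.B i)ᵀ *ᵥ ξ ⬝ᵥ v := by
      rw [mulVec_transpose, ← dotProduct_mulVec, ← dotProduct_add]
      simp only [dotProduct, hξ, mul_assoc]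
    have h2 := dotProduct_self_star_nonneg ((S.B i)ᵀ *ᵥ ξ - v)
    simp only [star_trivial, neg_mulVec, add_mulVec, dotProduct_neg, dotProduct_add, e1, e2, e3]
      at h1
    simp only [star_trivial, sub_dotProduct, dotProduct_sub, dotProduct_comm v] at h2
    rw [e4]
    linarith

/-- Controllability is a duality argument. With `y = Ax + Bv` and `ξ = Λ⁻¹ y`, the quantity `E = yᵀ
Λ⁻¹ y` equals `Aᵀξ·x + Bᵀξ·v`. Young's inequality bounds `2E` by `xᵀ Λ⁻¹ x + |v|²` plus the dual
quadratic forms, and the matrix inequality at `ξ` bounds the latter by `E`. -/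
theorem isDiscBalanced_of_posSemidef {S : LSS D n m p} {σ : Fin n → ℝ} (hσ : ∀ k, 0 < σ k)
    (hobs : ∀ i, (-((S.A i)ᵀ * diagonal σ * S.A i + (S.C i)ᵀ * S.C i - diagonal σ)).PosSemidef)
    (hctr : ∀ i, (-(S.A i * diagonal σ * (S.A i)ᵀ + S.B i * (S.B i)ᵀ - diagonal σ)).PosSemidef) :
    S.IsDiscBalanced σ where
  pos := hσ
  obs i x := by
    have h1 := (hobs i).dotProduct_mulVec_nonneg x
    have e1 : ∀ y : Fin n → ℝ, y ⬝ᵥ diagonal σ *ᵥ y = ∑ k, σ k * y k ^ 2 := by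
      intro y
      simp only [dotProduct, mulVec_diagonal]
      exact Finset.sum_congr rfl fun k _ => by ring
    have e2 : x ⬝ᵥ ((S.A i)ᵀ * diagonal σ * S.A i) *ᵥ x = ∑ k, σ k * (S.A i *ᵥ x) k ^ 2 := by
      rw [← e1, mul_assoc, ← mulVec_mulVec, ← mulVec_mulVec, dotProduct_mulVec,
        vecMul_transpose]
    have e3 : x ⬝ᵥ ((S.C i)ᵀ * S.C i) *ᵥ x = S.C i *ᵥ x ⬝ᵥ S.C i *ᵥ x := by
      rw [← mulVec_mulVec, dotProduct_mulVec, vecMul_transpose]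
    simp only [star_trivial, neg_mulVec, add_mulVec, sub_mulVec, dotProduct_neg, dotProduct_add,
      dotProduct_sub, e1, e2, e3] at h1
    linarith
  ctr i x v := by
    set y := S.A i *ᵥ x + S.B i *ᵥ v with hy
    set ξ : Fin n → ℝ := fun k => (σ k)⁻¹ * y k with hξ
    set α := (S.A i)ᵀ *ᵥ ξ with hα
    set β := (S.B i)ᵀ *ᵥ ξ with hβ
    have h1 := (hctr i).dotProduct_mulVec_nonneg ξ
    have e1 : ξ ⬝ᵥ diagonal σ *ᵥ ξ = ∑ k, (σ k)⁻¹ * y k ^ 2 := by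
      simp only [dotProduct, mulVec_diagonal, hξ]
      refine Finset.sum_congr rfl fun k _ => ?_
      have := (hσ k).ne'
      field_simp
    have e2 : ξ ⬝ᵥ (S.A i * diagonal σ * (S.A i)ᵀ) *ᵥ ξ = ∑ k, σ k * α k ^ 2 := by
      rw [mul_assoc, ← mulVec_mulVec, ← mulVec_mulVec, dotProduct_mulVec, ← mulVec_transpose]
      simp only [dotProduct, mulVec_diagonal, ← hα]
      exact Finset.sum_congr rfl fun k _ => by ring
    have e3 : ξ ⬝ᵥ (S.B i * (S.B i)ᵀ) *ᵥ ξ = β ⬝ᵥ β := by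
      rw [← mulVec_mulVec, dotProduct_mulVec, ← mulVec_transpose]
    have e4 : ∑ k, (σ k)⁻¹ * y k ^ 2 = α ⬝ᵥ x + β ⬝ᵥ v := by
      rw [hα, hβ, mulVec_transpose, mulVec_transpose, ← dotProduct_mulVec, ← dotProduct_mulVec,
        ← dotProduct_add, ← hy]
      simp only [dotProduct, hξ]
      exact Finset.sum_congr rfl fun k _ => by ring
    have h2 : 2 * (α ⬝ᵥ x) ≤ ∑ k, σ k * α k ^ 2 + ∑ k, (σ k)⁻¹ * x k ^ 2 := by
      rw [dotProduct, Finset.mul_sum, ← Finset.sum_add_distrib]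
      refine Finset.sum_le_sum fun k _ => ?_
      have h3 := mul_nonneg (inv_pos.2 (hσ k)).le (sq_nonneg (σ k * α k - x k))
      have h4 : (σ k)⁻¹ * (σ k * α k - x k) ^ 2 =
          σ k * α k ^ 2 - 2 * (α k * x k) + (σ k)⁻¹ * x k ^ 2 := by
        have := (hσ k).ne'
        field_simp
        ring
      linarith
    have h3 := dotProduct_self_star_nonneg (β - v)
    simp only [star_trivial, neg_mulVec, add_mulVec, sub_mulVec, dotProduct_neg, dotProduct_add,
      dotProduct_sub, e1, e2, e3] at h1
    simp only [star_trivial, sub_dotProduct, dotProduct_sub, dotProduct_comm v] at h3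
    linarith

/-! ### Invariance of outputs under a change of coordinates -/

theorem IsContTrajectory.changeBasis {S : LSS D n m p} {R : Matrix (Fin n) (Fin n) ℝ}
    (hR : IsUnit R.det) {u : L2Signal contTime m} {q : ContSwitching D}
    {x : ℝ → EuclideanSpace ℝ (Fin n)} (h : S.IsContTrajectory 0 u q x) :
    (S.changeBasis R).IsContTrajectory 0 u q (fun t => R.toEuclideanLin (x t)) where
  initial := by simp [h.initial]
  absolutelyContinuous T hT := (h.absolutelyContinuous T hT).continuousLinearMap_comp
    R.toEuclideanLin.toContinuousLinearMap
  hasDerivAt := by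
    filter_upwards [h.hasDerivAt] with t ht
    have h1 := R.toEuclideanLin.toContinuousLinearMap.hasFDerivAt.comp_hasDerivAt t ht
    refine h1.congr_deriv ?_
    ext1
    simp [LSS.changeBasis, mul_assoc, nonsing_inv_mul _ hR]

theorem changeBasis_C_apply {S : LSS D n m p} {R : Matrix (Fin n) (Fin n) ℝ}
    (hR : IsUnit R.det) (i : Fin D) (x : EuclideanSpace ℝ (Fin n)) :
    ((S.changeBasis R).C i).toEuclideanLin (R.toEuclideanLin x) = (S.C i).toEuclideanLin x := by
  ext1
  simp [changeBasis, mul_assoc, nonsing_inv_mul _ hR]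

theorem discState_changeBasis {S : LSS D n m p} {R : Matrix (Fin n) (Fin n) ℝ}
    (hR : IsUnit R.det) (u : L2Signal discTime m) (q : DiscSwitching D) (t : ℕ) :
    (S.changeBasis R).discState 0 u q t = R.toEuclideanLin (S.discState 0 u q t) := by
  induction t with
  | zero => simp [discState]
  | succ t ih =>
    rw [discState, discState, ih]
    ext1
    simp [changeBasis, mul_assoc, nonsing_inv_mul _ hR]

theorem discOutput_changeBasis {S : LSS D n m p} {R : Matrix (Fin n) (Fin n) ℝ}
    (hR : IsUnit R.det) (u : L2Signal discTime m) (q : DiscSwitching D) :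
    (S.changeBasis R).discOutput u q = S.discOutput u q := by
  ext1 t
  rw [discOutput, discOutput, discState_changeBasis hR, changeBasis_C_apply hR]

end LSS

/-! ### The error bound -/

theorem l2Norm_le_ofReal {T W : Type} [MeasurableSpace T] {μ : Measure T} {m p : ℕ}
    {F : L2Signal μ m → W → T → EuclideanSpace ℝ (Fin p)} {γ : ℝ} (hγ : 0 < γ)
    (h : ∀ u q, MemLp (F u q) 2 μ ∧
      eLpNorm (F u q) 2 μ ≤ ENNReal.ofReal γ * eLpNorm u.1 2 μ) :
    l2Norm F ≤ ENNReal.ofReal γ :=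
  iInf₂_le γ.toNNReal ⟨Real.toNNReal_pos.2 hγ, fun u q => (h u q).1,
    fun u => iSup_le fun q => (h u q).2⟩

end SwitchedSystem

open SwitchedSystem LSS MeasureTheory in
theorem mainTheorem1 (D n m p r : ℕ) (hD : 0 < D) (S : SwitchedSystem.LSS D n m p)
    (P Q : Matrix (Fin n) (Fin n) ℝ) (σ : Fin n → ℝ) (Shat : SwitchedSystem.LSS D r m p)
    (hbal : S.IsBalancedTruncation P Q σ r Shat) :
    (S.IsContCtrGrammian P → S.IsContObsGrammian Q →
      SwitchedSystem.l2Norm (fun u q => S.contOutput u q - Shat.contOutput u q) ≤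
        ENNReal.ofReal (2 * ∑ k ∈ Finset.univ.filter (fun k : Fin n => r ≤ (k : ℕ)), σ k)) ∧
    (S.IsDiscCtrGrammian P → S.IsDiscObsGrammian Q →
      SwitchedSystem.l2Norm (fun u q => S.discOutput u q - Shat.discOutput u q) ≤
        ENNReal.ofReal (2 * ∑ k ∈ Finset.univ.filter (fun k : Fin n => r ≤ (k : ℕ)), σ k)) := by
  obtain ⟨hr, U, K, hP, hK, hσ, -, hQ, rfl⟩ := hbal
  have hγ : 0 < 2 * ∑ k ∈ Finset.univ.filter (fun k : Fin n => r ≤ (k : ℕ)), σ k :=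
    mul_pos two_pos (Finset.sum_pos (fun k _ => hσ k) ⟨⟨r, hr⟩, by simp⟩)
  -- `det P = det U * det Uᵀ` is positive, so `U` is invertible.
  have hU : P.PosDef → IsUnit U.det := fun h => by
    have h1 := h.det_pos
    rw [hP, Matrix.det_mul] at h1
    exact isUnit_iff_ne_zero.2 (left_ne_zero_of_mul h1.ne')
  set R := Matrix.diagonal (fun k => √(σ k)) * K.transpose * U⁻¹ with hR
  refine ⟨fun hc ho => l2Norm_le_ofReal hγ fun u q => ?_,
    fun hc ho => l2Norm_le_ofReal hγ fun u q => ?_⟩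
  · have hdet : IsUnit R.det := isUnit_det_balancing (hU hc.1) hK hσ
    have hB : (S.changeBasis R).IsContBalanced σ := by
      refine isContBalanced_of_posSemidef hσ (fun i => ?_) (fun i => ?_)
      · simpa only [balancing_obs (hU hc.1) hK hσ hR hQ] using ho.changeBasis hdet i
      · simpa only [hP, balancing_ctr (hU hc.1) hK hσ hR] using hc.changeBasis hdet i
    have hx := Classical.choose_spec (S.exists_isContTrajectory 0 u q)
    have hx' := Classical.choose_spec
      (((S.changeBasis R).truncate r hr.le).exists_isContTrajectory 0 u q)
    -- Outputs are taken along any trajectory rather than the chosen one. The image under `R` of the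
    -- chosen trajectory of `S` then serves for the balanced system, with no appeal to uniqueness.
    refine output_sub_truncate_of_step (eLpNorm u.1 2 contTime) (fun _ S σ => S.IsContBalanced σ)
      (fun _ S y => ∃ x, S.IsContTrajectory 0 u q x ∧
        y = fun t => (S.C (q.1 t)).toEuclideanLin (x t))
      (fun _ _ _ h => h.pos) (fun _ S => ?_) (fun _ _ _ h => h.truncate) ?_ hr
      (S.changeBasis R) σ _ _ hB ⟨_, hx.changeBasis hdet, ?_⟩ ⟨_, hx', rfl⟩
    · obtain ⟨x, hx⟩ := S.exists_isContTrajectory 0 u q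
      exact ⟨_, x, hx, rfl⟩
    · rintro _ _ _ _ _ h ⟨x, hx, rfl⟩ ⟨x', hx', rfl⟩
      exact h.output_sub_truncate hx hx'
    · ext1 t
      rw [changeBasis_C_apply hdet]
      rfl
  · have hdet : IsUnit R.det := isUnit_det_balancing (hU hc.1) hK hσ
    have hB : (S.changeBasis R).IsDiscBalanced σ := by
      refine isDiscBalanced_of_posSemidef hσ (fun i => ?_) (fun i => ?_)
      · simpa only [balancing_obs (hU hc.1) hK hσ hR hQ] using ho.changeBasis hdet i
      · simpa only [hP, balancing_ctr (hU hc.1) hK hσ hR] using hc.changeBasis hdet i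
    refine output_sub_truncate_of_step (eLpNorm u.1 2 discTime) (fun _ S σ => S.IsDiscBalanced σ)
      (fun _ S y => y = S.discOutput u q)
      (fun _ _ _ h => h.pos) (fun _ S => ⟨_, rfl⟩) (fun _ _ _ h => h.truncate) ?_ hr
      (S.changeBasis R) σ _ _ hB (discOutput_changeBasis hdet u q).symm rfl
    rintro _ _ _ _ _ h rfl rfl
    exact h.output_sub_truncate u q
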